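/- Let $\mathsf{Ch}$ be the category of non-negatively graded cochain complexes over $\mathbb{Q}$, let $\mathsf{CDGA}$ be the category of commutative differential graded $\mathbb{Q}$-algebras (commutative monoids in $\mathsf{Ch}$), and let $p\mathcal{C}=\mathsf{Fun}([0,\infty),\mathcal{C})$ denote the category of functors from the poset $[0,\infty)$ to $\mathcal{C}$. Postcomposition with the free–forgetful adjunction between $\mathsf{Ch}$ and $\mathsf{CDGA}$ gives an adjunction $\Lambda : p\mathsf{Ch}\rightleftarrows p\mathsf{CDGA} : U$. For $k\in\mathbb{N}$ let $S^k$ be the complex with $\mathbb{Q}$ in degree $k$, and let $D^k$ be the complex with $\mathbb{Q}$ in degrees $k-1$ and $k$ and differential the identity, with $D^0=0$; let $S^k\to D^k$ be the natural map (zero for $k=0$). For $0\le s<t<\infty$ let $\mathbb{S}^k_{[s,t)}$ be the left Kan extension of $S^k\to D^k$ along $\{s<t\}\subseteq[0,\infty)$, and let $\mathbb{S}^k_{[s,\infty)}$ and $\mathbb{D}^k_s$ be the left Kan extensions of $S^k$ and $D^k$ along $\{s\}\subseteq[0,\infty)$. Put $$\mathbb{I}=\{\mathbb{S}^k_{[s,t)}\to\mathbb{D}^k_s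 \mid k\in\mathbb{N},\ 0\le s<t\le\infty\},$$ $$\mathbb{J}=\{\mathbb{D}^k_t\to\mathbb{D}^k_s \mid k\in\mathbb{N},\ 0\le s<t<\infty\}\cup\{0\to\mathbb{D}^k_s \mid k\in\mathbb{N},\ 0\le s<\infty\},$$ with the natural maps, and let $\mathbb{W}$ be the class of maps $f$ in $p\mathsf{Ch}$ such that $f(s)$ is a quasi-isomorphism for every $s\ge 0$. **Theorem.** There is a cofibrantly generated model structure on $p\mathsf{Ch}$ (the interval-sphere model structure) with weak equivalences $\mathbb{W}$, generating cofibrations $\mathbb{I}$ and generating trivial cofibrations $\mathbb{J}$. It transfers along $\Lambda\dashv U$: there is a combinatorial model structure on $p\mathsf{CDGA}$ in which a map $f$ is a weak equivalence (respectively a fibration) if and only if $Uf$ is one in the interval-sphere model structure. In particular its class of weak equivalences is $U^{-1}\mathbb{W}$, the pointwise quasi-isomorphisms; and $\Lambda\mathbb{I}$ and $\Lambda\mathbb{J}$ are sets of generating cofibrations and of generating trivial cofibrations for it. -/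

import Mathlib

open CategoryTheory CategoryTheory.Limits HomotopicalAlgebra
open scoped NNReal ZeroObject

noncomputable section

namespace IntervalSphere

/-! ## Cochain complexes and commutative differential graded algebras over `ℚ` -/

/-- Non-negatively graded cochain complexes of rational vector spaces. -/
abbrev Ch : Type 1 := CochainComplex (ModuleCat.{0} ℚ) ℕ

/-- A commutative differential graded algebra over `ℚ`: a commutative monoid in the symmetric
monoidal category `Ch` (tensor product of complexes, with the Koszul sign rule). The component
`Xⁱ ⊗ Xʲ → Xⁿ` of the multiplication is indexed by the proofs of `i + j = n`. The zero algebra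
is allowed. -/
structure CDGA : Type 1 where
  /-- the underlying cochain complex -/
  X : Ch
  /-- the unit -/
  one : X.X 0
  /-- the multiplication -/
  mul : ∀ {i j n : ℕ}, i + j = n → (X.X i →ₗ[ℚ] X.X j →ₗ[ℚ] X.X n)
  one_mul : ∀ {n : ℕ} (h : 0 + n = n) (a : X.X n), mul h one a = a
  mul_one : ∀ {n : ℕ} (h : n + 0 = n) (a : X.X n), mul h a one = a
  mul_assoc : ∀ {i j k ij jk n : ℕ} (hij : i + j = ij) (hjk : j + k = jk)
    (h : ij + k = n) (h' : i + jk = n) (a : X.X i) (b : X.X j) (c : X.X k),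
    mul h (mul hij a b) c = mul h' a (mul hjk b c)
  mul_comm : ∀ {i j n : ℕ} (h : i + j = n) (h' : j + i = n) (a : X.X i) (b : X.X j),
    mul h a b = (-1 : ℚ) ^ (i * j) • mul h' b a
  leibniz : ∀ {i j n : ℕ} (h : i + j = n) (h₁ : (i + 1) + j = n + 1) (h₂ : i + (j + 1) = n + 1)
    (a : X.X i) (b : X.X j),
    (X.d n (n + 1)).hom (mul h a b) =
      mul h₁ ((X.d i (i + 1)).hom a) b + (-1 : ℚ) ^ i • mul h₂ a ((X.d j (j + 1)).hom b)

namespace CDGA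

/-- A morphism of CDGAs: a cochain map that preserves the unit and the multiplication. -/
@[ext]
structure Hom (A B : CDGA) : Type where
  /-- the underlying cochain map -/
  map : A.X ⟶ B.X
  map_one : (map.f 0).hom A.one = B.one
  map_mul : ∀ {i j n : ℕ} (h : i + j = n) (a : A.X.X i) (b : A.X.X j),
    (map.f n).hom (A.mul h a b) = B.mul h ((map.f i).hom a) ((map.f j).hom b)

instance : Category CDGA where
  Hom := Hom
  id A := { map := 𝟙 A.X, map_one := by simp, map_mul := by intros; simp }
  comp f g :=
    { map := f.map ≫ g.map
      map_one := by simp [f.map_one, g.map_one]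
      map_mul := by intros; simp [f.map_mul, g.map_mul] }
  id_comp f := Hom.ext (Category.id_comp _)
  comp_id f := Hom.ext (Category.comp_id _)
  assoc f g h := Hom.ext (Category.assoc _ _ _)

/-- The forgetful functor from CDGAs to cochain complexes. -/
def U : CDGA ⥤ Ch where
  obj A := A.X
  map f := f.map

/-! ### The free CDGA on a cochain complex -/

/-- Formal homogeneous expressions in the elements of a cochain complex `V`. -/
inductive Expr (V : Ch) : ℕ → Type
  | of {n : ℕ} (v : V.X n) : Expr V n
  | zero (n : ℕ) : Expr V n
  | add {n : ℕ} (x y : Expr V n) : Expr V n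
  | smul {n : ℕ} (q : ℚ) (x : Expr V n) : Expr V n
  | one : Expr V 0
  | mul {i j n : ℕ} (h : i + j = n) (x : Expr V i) (y : Expr V j) : Expr V n
  | d {n : ℕ} (x : Expr V n) : Expr V (n + 1)

/-- The congruence on formal expressions that is generated by the axioms of a CDGA and by the
linear structure and the differential of `V`. -/
inductive Rel (V : Ch) : ∀ n : ℕ, Expr V n → Expr V n → Prop
  | refl {n} (x : Expr V n) : Rel V n x x
  | symm {n} {x y : Expr V n} : Rel V n x y → Rel V n y x
  | trans {n} {x y z : Expr V n} : Rel V n x y → Rel V n y z → Rel V n x z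
  -- compatibility with the operations
  | add_congr {n} {x x' y y' : Expr V n} :
      Rel V n x x' → Rel V n y y' → Rel V n (.add x y) (.add x' y')
  | smul_congr {n} (q : ℚ) {x x' : Expr V n} : Rel V n x x' → Rel V n (.smul q x) (.smul q x')
  | mul_congr {i j n} (h : i + j = n) {x x' : Expr V i} {y y' : Expr V j} :
      Rel V i x x' → Rel V j y y' → Rel V n (.mul h x y) (.mul h x' y')
  | d_congr {n} {x x' : Expr V n} : Rel V n x x' → Rel V (n + 1) (.d x) (.d x')
  -- vector space axioms in each degree
  | add_comm {n} (x y : Expr V n) : Rel V n (.add x y) (.add y x)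
  | add_assoc {n} (x y z : Expr V n) : Rel V n (.add (.add x y) z) (.add x (.add y z))
  | zero_add {n} (x : Expr V n) : Rel V n (.add (.zero n) x) x
  | neg_add {n} (x : Expr V n) : Rel V n (.add (.smul (-1) x) x) (.zero n)
  | one_smul {n} (x : Expr V n) : Rel V n (.smul 1 x) x
  | mul_smul {n} (p q : ℚ) (x : Expr V n) : Rel V n (.smul (p * q) x) (.smul p (.smul q x))
  | smul_add {n} (q : ℚ) (x y : Expr V n) :
      Rel V n (.smul q (.add x y)) (.add (.smul q x) (.smul q y))
  | add_smul {n} (p q : ℚ) (x : Expr V n) :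
      Rel V n (.smul (p + q) x) (.add (.smul p x) (.smul q x))
  | smul_zero {n} (q : ℚ) : Rel V n (.smul q (.zero n)) (.zero n)
  | zero_smul {n} (x : Expr V n) : Rel V n (.smul 0 x) (.zero n)
  -- bilinearity of the multiplication
  | add_mul {i j n} (h : i + j = n) (x x' : Expr V i) (y : Expr V j) :
      Rel V n (.mul h (.add x x') y) (.add (.mul h x y) (.mul h x' y))
  | mul_add {i j n} (h : i + j = n) (x : Expr V i) (y y' : Expr V j) :
      Rel V n (.mul h x (.add y y')) (.add (.mul h x y) (.mul h x y'))
  | smul_mul {i j n} (h : i + j = n) (q : ℚ) (x : Expr V i) (y : Expr V j) :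
      Rel V n (.mul h (.smul q x) y) (.smul q (.mul h x y))
  | mul_smul_comm {i j n} (h : i + j = n) (q : ℚ) (x : Expr V i) (y : Expr V j) :
      Rel V n (.mul h x (.smul q y)) (.smul q (.mul h x y))
  -- unital, associative, graded commutative
  | one_mul {n} (h : 0 + n = n) (x : Expr V n) : Rel V n (.mul h .one x) x
  | mul_one {n} (h : n + 0 = n) (x : Expr V n) : Rel V n (.mul h x .one) x
  | mul_assoc {i j k ij jk n} (hij : i + j = ij) (hjk : j + k = jk) (h : ij + k = n)
      (h' : i + jk = n) (x : Expr V i) (y : Expr V j) (z : Expr V k) :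
      Rel V n (.mul h (.mul hij x y) z) (.mul h' x (.mul hjk y z))
  | mul_comm {i j n} (h : i + j = n) (h' : j + i = n) (x : Expr V i) (y : Expr V j) :
      Rel V n (.mul h x y) (.smul ((-1) ^ (i * j)) (.mul h' y x))
  -- the differential
  | d_add {n} (x y : Expr V n) : Rel V (n + 1) (.d (.add x y)) (.add (.d x) (.d y))
  | d_smul {n} (q : ℚ) (x : Expr V n) : Rel V (n + 1) (.d (.smul q x)) (.smul q (.d x))
  | d_d {n} (x : Expr V n) : Rel V (n + 1 + 1) (.d (.d x)) (.zero _)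
  | leibniz {i j n} (h : i + j = n) (h₁ : (i + 1) + j = n + 1) (h₂ : i + (j + 1) = n + 1)
      (x : Expr V i) (y : Expr V j) :
      Rel V (n + 1) (.d (.mul h x y))
        (.add (.mul h₁ (.d x) y) (.smul ((-1) ^ i) (.mul h₂ x (.d y))))
  -- the generators
  | of_add {n} (v w : V.X n) : Rel V n (.of (v + w)) (.add (.of v) (.of w))
  | of_smul {n} (q : ℚ) (v : V.X n) : Rel V n (.of (q • v)) (.smul q (.of v))
  | of_d {n} (v : V.X n) : Rel V (n + 1) (.of ((V.d n (n + 1)).hom v)) (.d (.of v))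

/-- The setoid of `Rel`. -/
def relSetoid (V : Ch) (n : ℕ) : Setoid (Expr V n) where
  r := Rel V n
  iseqv := ⟨Rel.refl, Rel.symm, Rel.trans⟩

/-- The degree `n` part of the free CDGA on `V`. -/
def FreePart (V : Ch) (n : ℕ) : Type := Quotient (relSetoid V n)

variable {V : Ch}

/-- The class of a formal expression. -/
def FreePart.mk {n : ℕ} (x : Expr V n) : FreePart V n := Quotient.mk (relSetoid V n) x

lemma FreePart.sound {n : ℕ} {x y : Expr V n} (h : Rel V n x y) :
    FreePart.mk x = FreePart.mk y := Quotient.sound h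

lemma FreePart.mk_surjective {n : ℕ} (a : FreePart V n) : ∃ x, FreePart.mk x = a :=
  Quotient.exists_rep a

instance (n : ℕ) : Zero (FreePart V n) := ⟨FreePart.mk (.zero n)⟩

instance (n : ℕ) : Add (FreePart V n) :=
  ⟨Quotient.map₂ .add fun _ _ h _ _ h' => Rel.add_congr h h'⟩

instance (n : ℕ) : Neg (FreePart V n) :=
  ⟨Quotient.map (.smul (-1)) fun _ _ h => Rel.smul_congr _ h⟩

instance (n : ℕ) : AddCommGroup (FreePart V n) where
  add_assoc := by rintro ⟨x⟩ ⟨y⟩ ⟨z⟩; exact FreePart.sound (Rel.add_assoc x y z)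
  zero_add := by rintro ⟨x⟩; exact FreePart.sound (Rel.zero_add x)
  add_zero := by
    rintro ⟨x⟩; exact FreePart.sound ((Rel.add_comm _ _).trans (Rel.zero_add x))
  neg_add_cancel := by rintro ⟨x⟩; exact FreePart.sound (Rel.neg_add x)
  add_comm := by rintro ⟨x⟩ ⟨y⟩; exact FreePart.sound (Rel.add_comm x y)
  nsmul := nsmulRec
  zsmul := zsmulRec

instance (n : ℕ) : Module ℚ (FreePart V n) where
  smul q := Quotient.map (.smul q) fun _ _ h => Rel.smul_congr q h
  one_smul := by rintro ⟨x⟩; exact FreePart.sound (Rel.one_smul x)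
  mul_smul := by rintro p q ⟨x⟩; exact FreePart.sound (Rel.mul_smul p q x)
  smul_add := by rintro q ⟨x⟩ ⟨y⟩; exact FreePart.sound (Rel.smul_add q x y)
  smul_zero q := FreePart.sound (Rel.smul_zero q)
  add_smul := by rintro p q ⟨x⟩; exact FreePart.sound (Rel.add_smul p q x)
  zero_smul := by rintro ⟨x⟩; exact FreePart.sound (Rel.zero_smul x)

/-- The differential of the free CDGA. -/
def FreePart.d (n : ℕ) : FreePart V n →ₗ[ℚ] FreePart V (n + 1) where
  toFun := Quotient.map .d fun _ _ h => Rel.d_congr h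
  map_add' := by rintro ⟨x⟩ ⟨y⟩; exact FreePart.sound (Rel.d_add x y)
  map_smul' := by rintro q ⟨x⟩; exact FreePart.sound (Rel.d_smul q x)

/-- The multiplication of the free CDGA. -/
def FreePart.mul {i j n : ℕ} (h : i + j = n) :
    FreePart V i →ₗ[ℚ] FreePart V j →ₗ[ℚ] FreePart V n :=
  LinearMap.mk₂ ℚ (Quotient.map₂ (.mul h) fun _ _ h₁ _ _ h₂ => Rel.mul_congr h h₁ h₂)
    (by rintro ⟨x⟩ ⟨y⟩ ⟨z⟩; exact FreePart.sound (Rel.add_mul h x y z))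
    (by rintro q ⟨x⟩ ⟨y⟩; exact FreePart.sound (Rel.smul_mul h q x y))
    (by rintro ⟨x⟩ ⟨y⟩ ⟨z⟩; exact FreePart.sound (Rel.mul_add h x y z))
    (by rintro q ⟨x⟩ ⟨y⟩; exact FreePart.sound (Rel.mul_smul_comm h q x y))

/-- The underlying cochain complex of the free CDGA. -/
def freeComplex (V : Ch) : Ch :=
  CochainComplex.of (fun n => ModuleCat.of ℚ (FreePart V n))
    (fun n => ModuleCat.ofHom (FreePart.d n))
    (fun n => by
      ext a
      obtain ⟨x, rfl⟩ := FreePart.mk_surjective a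
      exact FreePart.sound (Rel.d_d x))

lemma freeComplex_d (V : Ch) (n : ℕ) :
    (freeComplex V).d n (n + 1) = ModuleCat.ofHom (FreePart.d n) :=
  CochainComplex.of_d (fun n => ModuleCat.of ℚ (FreePart V n))
    (fun n => ModuleCat.ofHom (FreePart.d n)) n

/-- The free CDGA on a cochain complex. -/
def freeObj (V : Ch) : CDGA where
  X := freeComplex V
  one := FreePart.mk .one
  mul h := FreePart.mul h
  one_mul := by rintro n h ⟨x⟩; exact FreePart.sound (Rel.one_mul h x)
  mul_one := by rintro n h ⟨x⟩; exact FreePart.sound (Rel.mul_one h x)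
  mul_assoc := by
    rintro i j k ij jk n hij hjk h h' ⟨x⟩ ⟨y⟩ ⟨z⟩
    exact FreePart.sound (Rel.mul_assoc hij hjk h h' x y z)
  mul_comm := by
    rintro i j n h h' ⟨x⟩ ⟨y⟩
    exact FreePart.sound (Rel.mul_comm h h' x y)
  leibniz := by
    rintro i j n h h₁ h₂ ⟨x⟩ ⟨y⟩
    rw [freeComplex_d, freeComplex_d, freeComplex_d]
    exact FreePart.sound (Rel.leibniz h h₁ h₂ x y)

/-- The inclusion of the generators. -/
def freeUnit (V : Ch) : V ⟶ (freeObj V).X where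
  f n := ModuleCat.ofHom (Y := FreePart V n)
    { toFun := fun v => FreePart.mk (.of v)
      map_add' := fun v w => FreePart.sound (Rel.of_add v w)
      map_smul' := fun q v => FreePart.sound (Rel.of_smul q v) }
  comm' := by
    rintro i _ rfl
    change _ ≫ (freeComplex V).d i (i + 1) = _
    rw [freeComplex_d]
    ext v
    exact FreePart.sound (Rel.of_d v).symm

/-- Evaluation of formal expressions along a cochain map to a CDGA. -/
def exprValue {A : CDGA} (f : V ⟶ A.X) : ∀ {n : ℕ}, Expr V n → A.X.X n
  | n, .of v => (f.f n).hom v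
  | _, .zero _ => 0
  | _, .add x y => exprValue f x + exprValue f y
  | _, .smul q x => q • exprValue f x
  | _, .one => A.one
  | _, .mul h x y => A.mul h (exprValue f x) (exprValue f y)
  | _, .d (n := n) x => (A.X.d n (n + 1)).hom (exprValue f x)

lemma exprValue_rel {A : CDGA} (f : V ⟶ A.X) {n : ℕ} {x y : Expr V n} (h : Rel V n x y) :
    exprValue f x = exprValue f y := by
  induction h with
  | refl => rfl
  | symm _ ih => exact ih.symm
  | trans _ _ ih₁ ih₂ => exact ih₁.trans ih₂
  | add_congr _ _ ih₁ ih₂ => simp only [exprValue, ih₁, ih₂]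
  | smul_congr _ _ ih => simp only [exprValue, ih]
  | mul_congr _ _ _ ih₁ ih₂ => simp only [exprValue, ih₁, ih₂]
  | d_congr _ ih => simp only [exprValue, ih]
  | add_comm => exact add_comm _ _
  | add_assoc => exact add_assoc _ _ _
  | zero_add => exact zero_add _
  | neg_add => simp [exprValue]
  | one_smul => exact one_smul _ _
  | mul_smul => exact SemigroupAction.mul_smul _ _ _
  | smul_add => exact smul_add _ _ _
  | add_smul => exact add_smul _ _ _
  | smul_zero => exact smul_zero _
  | zero_smul => exact zero_smul _ _
  | add_mul => simp [exprValue]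
  | mul_add => simp [exprValue]
  | smul_mul => simp [exprValue]
  | mul_smul_comm => simp [exprValue]
  | one_mul => exact A.one_mul _ _
  | mul_one => exact A.mul_one _ _
  | mul_assoc => exact A.mul_assoc _ _ _ _ _ _ _
  | mul_comm => exact A.mul_comm _ _ _ _
  | d_add => simp [exprValue]
  | d_smul => simp [exprValue]
  | @d_d n x =>
    have := A.X.d_comp_d n (n + 1) (n + 1 + 1)
    exact congrArg (fun g => g.hom (exprValue f x)) this
  | leibniz => exact A.leibniz _ _ _ _ _
  | of_add => simp [exprValue]
  | of_smul => simp [exprValue]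
  | @of_d n v =>
    have := (f.comm n (n + 1)).symm
    exact congrArg (fun g => g.hom v) this

/-- The morphism of CDGAs out of a free CDGA that extends a cochain map. -/
def freeLift {A : CDGA} (f : V ⟶ A.X) : freeObj V ⟶ A where
  map :=
    { f := fun n => ModuleCat.ofHom (X := FreePart V n)
        { toFun := Quotient.lift (exprValue f) fun _ _ h => exprValue_rel f h
          map_add' := by rintro ⟨x⟩ ⟨y⟩; rfl
          map_smul' := by rintro q ⟨x⟩; rfl }
      comm' := by
        rintro i _ rfl
        change _ = (freeComplex V).d i (i + 1) ≫ _
        rw [freeComplex_d]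
        ext a
        obtain ⟨x, rfl⟩ := FreePart.mk_surjective a
        rfl }
  map_one := rfl
  map_mul := by rintro i j n h ⟨x⟩ ⟨y⟩; rfl

lemma freeLift_unit {A : CDGA} (f : V ⟶ A.X) : freeUnit V ≫ (freeLift f).map = f := by
  ext n v
  rfl

lemma free_hom_apply {A : CDGA} (g : freeObj V ⟶ A) {n : ℕ} (x : Expr V n) :
    (g.map.f n).hom (FreePart.mk x) = exprValue (freeUnit V ≫ g.map) x := by
  induction x with
  | of v => rfl
  | zero n => exact map_zero (g.map.f n).hom
  | add x y hx hy =>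
    exact (map_add (g.map.f _).hom (FreePart.mk x : FreePart V _) (FreePart.mk y)).trans
      (congrArg₂ _ hx hy)
  | smul q x hx =>
    exact (map_smul (g.map.f _).hom q (FreePart.mk x : FreePart V _)).trans
      (congrArg (q • ·) hx)
  | one => exact g.map_one
  | mul h x y hx hy =>
    refine (g.map_mul h (FreePart.mk x : FreePart V _) (FreePart.mk y : FreePart V _)).trans ?_
    rw [hx, hy]
    rfl
  | @d n x hx =>
    have := congrArg (fun φ => φ.hom (FreePart.mk x : FreePart V _)) (g.map.comm n (n + 1))
    change (A.X.d n (n + 1)).hom ((g.map.f n).hom (FreePart.mk x)) =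
      (g.map.f (n + 1)).hom (((freeComplex V).d n (n + 1)).hom (FreePart.mk x)) at this
    rw [freeComplex_d, hx] at this
    exact this.symm

/-- The universal property of the free CDGA. -/
def freeHomEquiv (V : Ch) (A : CDGA) : (freeObj V ⟶ A) ≃ (V ⟶ U.obj A) where
  toFun g := freeUnit V ≫ U.map g
  invFun f := freeLift f
  left_inv g := by
    refine Hom.ext ?_
    ext n a
    obtain ⟨x, rfl⟩ := FreePart.mk_surjective (V := V) a
    exact (free_hom_apply g x).symm
  right_inv f := freeLift_unit f

/-- The free CDGA functor `Λ`. -/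
def Λ : Ch ⥤ CDGA :=
  Adjunction.leftAdjointOfEquiv (G := U) freeHomEquiv fun _ _ _ _ _ => rfl

/-- The free–forgetful adjunction. -/
def freeForget : Λ ⊣ U := Adjunction.adjunctionOfEquivLeft freeHomEquiv _

end CDGA

/-! ## Persistent objects -/

/-- Persistent cochain complexes: functors from the poset `[0, ∞)` to cochain complexes. -/
abbrev PCh : Type 1 := ℝ≥0 ⥤ Ch

/-- Persistent CDGAs: functors from the poset `[0, ∞)` to CDGAs. -/
abbrev PCDGA : Type 1 := ℝ≥0 ⥤ CDGA

/-- The free functor on persistent objects (postcomposition with `CDGA.Λ`). -/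
abbrev pΛ : PCh ⥤ PCDGA := (Functor.whiskeringRight ℝ≥0 Ch CDGA).obj CDGA.Λ

/-- The forgetful functor on persistent objects (postcomposition with `CDGA.U`). -/
abbrev pU : PCDGA ⥤ PCh := (Functor.whiskeringRight ℝ≥0 CDGA Ch).obj CDGA.U

/-- The free–forgetful adjunction on persistent objects. -/
def pFreeForget : pΛ ⊣ pU := CDGA.freeForget.whiskerRight ℝ≥0

/-- The pointwise quasi-isomorphisms. -/
def pW : MorphismProperty PCh := fun _ _ f => ∀ s : ℝ≥0, QuasiIso (f.app s)

/-! ## Spheres and disks -/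

/-- The complex `Sᵏ`: one copy of `ℚ`, in degree `k`. -/
def S (k : ℕ) : Ch := (HomologicalComplex.single _ _ k).obj (ModuleCat.of ℚ ℚ)

lemma rel_succ (m : ℕ) : (ComplexShape.up ℕ).Rel m (m + 1) := by simp

/-- The complex `Dᵐ⁺¹`: a copy of `ℚ` in each of the degrees `m` and `m + 1`, with differential
the identity. -/
def DSucc (m : ℕ) : Ch := HomologicalComplex.double (𝟙 (ModuleCat.of ℚ ℚ)) (rel_succ m)

/-- The disk complex `Dᵏ`; by convention `D⁰ = 0`. -/
def D : ℕ → Ch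
  | 0 => 0
  | m + 1 => DSucc m

/-- The map `Sᵐ⁺¹ → Dᵐ⁺¹`, which is the identity of `ℚ` in degree `m + 1`. -/
def SToDSucc (m : ℕ) : S (m + 1) ⟶ DSucc m :=
  HomologicalComplex.mkHomFromSingle
    (K := HomologicalComplex.double (𝟙 (ModuleCat.of ℚ ℚ)) (rel_succ m))
    (HomologicalComplex.doubleXIso₁ _ (rel_succ m) (Nat.succ_ne_self m).symm).inv
    (fun j _ => by
      rw [HomologicalComplex.double_d_eq_zero₀ _ _ _ _ (Nat.succ_ne_self m), comp_zero])

/-- The map `Sᵏ → Dᵏ`; it is zero for `k = 0`. -/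
def SToD : ∀ k : ℕ, S k ⟶ D k
  | 0 => 0
  | m + 1 => SToDSucc m

/-- The left Kan extension along `{s} ⊆ [0, ∞)` of the functor with value `K`. -/
def lanPoint (s : ℝ≥0) (K : Ch) : PCh :=
  (Functor.fromPUnit s).leftKanExtension (Functor.fromPUnit K)

/-- The unit `K → (lanPoint s K)(s)` of the left Kan extension. -/
def lanPointUnit (s : ℝ≥0) (K : Ch) : K ⟶ (lanPoint s K).obj s :=
  ((Functor.fromPUnit s).leftKanExtensionUnit (Functor.fromPUnit K)).app ⟨⟨⟩⟩

/-- The morphism out of `lanPoint s K` that corresponds to a morphism `K → X(s)`. -/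
def lanPointDesc {s : ℝ≥0} {K : Ch} {X : PCh} (φ : K ⟶ X.obj s) : lanPoint s K ⟶ X :=
  ((Functor.fromPUnit s).leftKanExtension (Functor.fromPUnit K)).descOfIsLeftKanExtension
    ((Functor.fromPUnit s).leftKanExtensionUnit (Functor.fromPUnit K)) X
    { app := fun _ => φ
      naturality := fun _ _ _ => by simp }

/-- The persistent disk `𝔻ᵏₛ`. -/
def pDisk (s : ℝ≥0) (k : ℕ) : PCh := lanPoint s (D k)

/-- The interval sphere `𝕊ᵏ_[s,t)` for finite `t`: the left Kan extension along `{s < t} ⊆ [0, ∞)`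
of the functor `Sᵏ → Dᵏ`. -/
def pSphere {s t : ℝ≥0} (h : s < t) (k : ℕ) : PCh :=
  (ComposableArrows.mk₁ (homOfLE h.le)).leftKanExtension (ComposableArrows.mk₁ (SToD k))

/-- The interval sphere `𝕊ᵏ_[s,∞)`: the left Kan extension of `Sᵏ` along `{s} ⊆ [0, ∞)`. -/
def pSphereTop (s : ℝ≥0) (k : ℕ) : PCh := lanPoint s (S k)

/-- The inclusion `𝔻ᵏₜ → 𝔻ᵏₛ` for `s ≤ t`, induced by `Dᵏ = 𝔻ᵏₛ(s) → 𝔻ᵏₛ(t)`. -/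
def pDiskMap {s t : ℝ≥0} (h : s ≤ t) (k : ℕ) : pDisk t k ⟶ pDisk s k :=
  lanPointDesc (lanPointUnit s (D k) ≫ (pDisk s k).map (homOfLE h))

/-- The map `𝕊ᵏ_[s,t) → 𝔻ᵏₛ` for finite `t`, given by `Sᵏ → Dᵏ` at `s` and by the identity of
`Dᵏ` at `t`. -/
def pSphereToDisk {s t : ℝ≥0} (h : s < t) (k : ℕ) : pSphere h k ⟶ pDisk s k :=
  ((ComposableArrows.mk₁ (homOfLE h.le)).leftKanExtension
      (ComposableArrows.mk₁ (SToD k))).descOfIsLeftKanExtension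
    ((ComposableArrows.mk₁ (homOfLE h.le)).leftKanExtensionUnit (ComposableArrows.mk₁ (SToD k)))
    (pDisk s k)
    (ComposableArrows.homMk₁
      (SToD k ≫ lanPointUnit s (D k))
      (lanPointUnit s (D k) ≫ (pDisk s k).map (homOfLE h.le))
      (Category.assoc _ _ _).symm)

/-- The map `𝕊ᵏ_[s,∞) → 𝔻ᵏₛ`, given by `Sᵏ → Dᵏ` at `s`. -/
def pSphereTopToDisk (s : ℝ≥0) (k : ℕ) : pSphereTop s k ⟶ pDisk s k :=
  lanPointDesc (SToD k ≫ lanPointUnit s (D k))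

/-- The set `𝕀` of the maps `𝕊ᵏ_[s,t) → 𝔻ᵏₛ` for `0 ≤ s < t ≤ ∞` and `k ∈ ℕ`. -/
inductive genI : MorphismProperty PCh
  | finite {s t : ℝ≥0} (h : s < t) (k : ℕ) : genI (pSphereToDisk h k)
  | infinite (s : ℝ≥0) (k : ℕ) : genI (pSphereTopToDisk s k)

/-- The set `𝕁` of the maps `𝔻ᵏₜ → 𝔻ᵏₛ` for `0 ≤ s < t < ∞` and `0 → 𝔻ᵏₛ` for `0 ≤ s < ∞`,
with `k ∈ ℕ`. -/
inductive genJ : MorphismProperty PCh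
  | finite {s t : ℝ≥0} (h : s < t) (k : ℕ) : genJ (pDiskMap h.le k)
  | infinite (s : ℝ≥0) (k : ℕ) : genJ (0 : (0 : PCh) ⟶ pDisk s k)

/-! ## Cofibrantly generated, combinatorial and transferred model structures -/

/-- The model structure on `C` is cofibrantly generated, with `I` as a set of generating
cofibrations and `J` as a set of generating trivial cofibrations: both are (small) sets that permit
the small object argument, the fibrations are the maps with the right lifting property with respect
to `J`, and the trivial fibrations are those with the right lifting property with respect to `I`. -/
structure IsCofibrantlyGeneratedBy {C : Type 1} [Category.{0} C] [ModelCategory C]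
    (I J : MorphismProperty C) : Prop where
  isSmall_I : MorphismProperty.IsSmall.{0} I
  isSmall_J : MorphismProperty.IsSmall.{0} J
  smallObject_I : MorphismProperty.HasSmallObjectArgument.{0} I
  smallObject_J : MorphismProperty.HasSmallObjectArgument.{0} J
  fibrations_eq : fibrations C = J.rlp
  trivialFibrations_eq : trivialFibrations C = I.rlp

/-- The model structure on `C` is combinatorial, with generating sets `I` and `J`: it is
cofibrantly generated by them and `C` is locally presentable. -/
structure IsCombinatorialBy {C : Type 1} [Category.{0} C] [ModelCategory C]
    (I J : MorphismProperty C) : Prop extends IsCofibrantlyGeneratedBy I J where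
  isLocallyPresentable : IsLocallyPresentable.{0} C

/-- The model structure on `C'` is transferred from that on `C` along `R : C' ⥤ C`: the weak
equivalences and the fibrations are the maps that `R` sends to such. -/
structure IsTransferredAlong {C C' : Type 1} [Category.{0} C] [Category.{0} C']
    [ModelCategory C] [ModelCategory C'] (R : C' ⥤ C) : Prop where
  weakEquivalences_eq : weakEquivalences C' = (weakEquivalences C).inverseImage R
  fibrations_eq : fibrations C' = (fibrations C).inverseImage R

end IntervalSphere

end

open IntervalSphere

/-! ### The small object argument and the recognition theorem. -/

namespace CategoryTheory

universe w v u

open MorphismProperty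

/-! Both model structures come from one recognition theorem, `exists_modelCategory_of_isSmall`: in a
locally presentable category, sets `I`, `J` and a class `W` with two-out-of-three generate a model
structure as soon as `I.rlp = J.rlp ⊓ W` and `J.rlp.llp ≤ W`.

Trivial fibrations. By the universal property of the Kan extensions, lifting against 𝕁 means that
all maps `X(s) → Y(s)` and `X(s) → Y(s) ×_{Y(t)} X(t)` are surjective in every degree
(`genJ_rlp_iff`), and lifting against 𝕀 prescribes in addition the differential of the lift
(`genI_rlp_iff`). The first condition, `genI_rlp_eq`, is then a diagram chase: the kernel of a
surjective quasi-isomorphism is acyclic, so a solution at `s` with the wrong image at `t` is off by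
some `du` with `u` in the kernel, and `u` lifts to `s` by the property for 𝕁. For CDGAs the
condition is pulled back along the adjunction (`rlp_strictMap_eq`).

Acyclicity. Evaluation at `r` has a right adjoint, whose values are `X` at `s ≤ r` and terminal
elsewhere. It sends surjections to maps that lift against 𝕁 (`genJ_rlp_evaluationRightAdjoint_map`).
Hence, if `f` lifts against all fibrations, `f(r)` lifts against all surjections, and Quillen's path
object argument (`quasiIso_of_llp_surjections`) makes it a quasi-isomorphism: lifting against `A →
1` gives a retraction `g`, and lifting against `P → B × B` gives a homotopy from the identity to
`fg`. The path object is `B[t, dt]`, where integration over `[0, 1]` shows that the two ends of a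
cocycle are cohomologous. The argument is uniform in an adjunction `F ⊣ G` over `Ch`; the identity
adjunction and the free–forgetful one are the two cases.

Local presentability. The disks are finitely presentable and form a strong generator of `Ch`. The
free CDGAs on them do the same for `CDGA`, which is cocomplete and whose forgetful functor is
faithful, conservative and preserves filtered colimits. Functor categories inherit the property. -/

/-- In a locally presentable category, every (small) set of morphisms permits the small object
argument. -/
lemma MorphismProperty.hasSmallObjectArgument_of_isLocallyPresentable {C : Type u} [Category.{v} C]
    [IsLocallyPresentable.{w} C] (I : MorphismProperty C) [IsSmall.{w} I] :
    HasSmallObjectArgument.{w} I := by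
  obtain ⟨κ₀, _, _⟩ := IsLocallyPresentable.exists_cardinal.{w} C
  have : LocallySmall.{w} C := inferInstance
  obtain ⟨ι, A, B, f, hI⟩ := (isSmall_iff_eq_ofHoms I).1 inferInstance
  have hA (i : ι) : IsPresentable.{w} (A i) := inferInstance
  choose κ' hκ' h' using fun i => (hA i).exists_cardinal
  -- The sum bounds the presentability ranks of all the sources at once, and the successor of an
  -- infinite cardinal is regular.
  let μ : Cardinal.{w} := max Cardinal.aleph0 (Cardinal.sum κ')
  let κ := Order.succ μ
  have hκ : κ.IsRegular := Cardinal.isRegular_succ (le_max_left _ _)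
  have : Fact κ.IsRegular := ⟨hκ⟩
  have hne : Nonempty κ.ord.ToType := by
    rw [← Cardinal.mk_ne_zero_iff, Cardinal.mk_ord_toType]
    exact hκ.pos.ne'
  let : OrderBot κ.ord.ToType := WellFoundedLT.toOrderBot _
  refine ⟨κ, inferInstance, inferInstance, ?_⟩
  refine { preservesColimit := ?_, hasCoproducts := fun _ => inferInstance }
  intro A' B' X Y i hi g hg
  rw [hI] at hi
  obtain ⟨i⟩ := hi
  have := hκ' i
  have : IsCardinalPresentable (A i) (κ' i) := h' i
  have hle : κ' i ≤ κ := (Cardinal.le_sum κ' i).trans ((le_max_right _ _).trans (Order.le_succ μ))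
  have : IsCardinalPresentable (A i) κ := isCardinalPresentable_of_le _ hle
  have := preservesColimitsOfShape_of_isCardinalPresentable (A i) κ κ.ord.ToType
  infer_instance

end CategoryTheory

namespace IntervalSphere

open MorphismProperty

/-- The recognition theorem for cofibrantly generated model structures. -/
lemma exists_modelCategory_of_isSmall {C : Type 1} [Category.{0} C]
    [HasFiniteLimits C] [IsLocallyPresentable.{0} C] (I J W : MorphismProperty C)
    [IsSmall.{0} I] [IsSmall.{0} J] [W.HasTwoOutOfThreeProperty]
    (hIJ : I.rlp = J.rlp ⊓ W) (hJ : J.rlp.llp ≤ W) :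
    ∃ _ : ModelCategory C, weakEquivalences C = W ∧ IsCofibrantlyGeneratedBy I J := by
  have : HasSmallObjectArgument.{0} I := I.hasSmallObjectArgument_of_isLocallyPresentable
  have : HasSmallObjectArgument.{0} J := J.hasSmallObjectArgument_of_isLocallyPresentable
  have : HasColimitsOfSize.{0, 0} C := by
    obtain ⟨κ, _, _⟩ := IsLocallyPresentable.exists_cardinal.{0} C
    infer_instance
  let : CategoryWithFibrations C := ⟨J.rlp⟩
  let : CategoryWithCofibrations C := ⟨I.rlp.llp⟩
  let : CategoryWithWeakEquivalences C := ⟨W⟩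
  have hIJ' : I.rlp ≤ J.rlp := hIJ.le.trans inf_le_left
  have htc : trivialCofibrations C = J.rlp.llp := by
    refine le_antisymm ?_ (le_inf (antitone_llp hIJ') hJ)
    rintro X Y f ⟨hf, hf'⟩
    -- Retract argument: two-out-of-three puts the second factor in `W`, hence in `I.rlp`, so `f`
    -- lifts against it and is a retract of the first factor.
    let d := factorizationData J.rlp.llp J.rlp f
    have hp : W d.p := W.of_precomp d.i d.p (hJ _ d.hi) (by rw [d.fac]; exact hf')
    have hp' : I.rlp d.p := by rw [hIJ]; exact ⟨d.hp, hp⟩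
    have : HasLiftingProperty f d.p := hf _ hp'
    exact of_retract (P := J.rlp.llp) (RetractArrow.ofLeftLiftingProperty d.fac) d.hi
  have htf : trivialFibrations C = I.rlp := hIJ.symm
  have : (weakEquivalences C).HasTwoOutOfThreeProperty :=
    inferInstanceAs W.HasTwoOutOfThreeProperty
  have h₁ : IsWeakFactorizationSystem (cofibrations C) (trivialFibrations C) := by
    rw [htf]
    change IsWeakFactorizationSystem I.rlp.llp I.rlp
    refine { rlp := ?_ , llp := ?_, hasFactorization := inferInstance }
    all_goals simp
  have h₂ : IsWeakFactorizationSystem (trivialCofibrations C) (fibrations C) := by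
    rw [htc]
    change IsWeakFactorizationSystem J.rlp.llp J.rlp
    refine { rlp := ?_ , llp := ?_, hasFactorization := inferInstance }
    all_goals simp
  let M : ModelCategory C := ModelCategory.mk' C
  refine ⟨M, rfl, ?_⟩
  exact
    { isSmall_I := inferInstance
      isSmall_J := inferInstance
      smallObject_I := inferInstance
      smallObject_J := inferInstance
      fibrations_eq := rfl
      trivialFibrations_eq := htf }

end IntervalSphere

noncomputable section
namespace IntervalSphere
attribute [-instance] CategoryTheory.catToReflQuiver

/-! ## Cochain complexes in terms of elements -/

lemma Ch.f_d_apply {X Y : Ch} (f : X ⟶ Y) (m n : ℕ) (x : X.X m) :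
    (f.f n).hom ((X.d m n).hom x) = (Y.d m n).hom ((f.f m).hom x) :=
  congrArg (fun g => g.hom x) (f.comm m n).symm

lemma Ch.d_d_apply (X : Ch) (l m n : ℕ) (x : X.X l) :
    (X.d m n).hom ((X.d l m).hom x) = 0 :=
  congrArg (fun g => g.hom x) (X.d_comp_d l m n)

lemma Ch.comp_f_apply {X Y Z : Ch} (f : X ⟶ Y) (g : Y ⟶ Z) (n : ℕ) (x : X.X n) :
    ((f ≫ g).f n).hom x = (g.f n).hom ((f.f n).hom x) := rfl

/-- Truncated subtraction gives `0 - 1 = 0`, and `d 0 0` vanishes. With this convention "`x` is in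
the image of `d (n - 1) n`" means `x = 0` when `n = 0`, so coboundaries need no case distinction. -/
lemma Ch.d_zero_left (X : Ch) (z : X.X 0) : (X.d (0 - 1) 0).hom z = 0 :=
  congrArg (fun g => g.hom z) (X.shape 0 0 (by simp))

lemma Ch.next_eq (n : ℕ) : (ComplexShape.up ℕ).next n = n + 1 := by simp

lemma Ch.prev_eq (n : ℕ) : (ComplexShape.up ℕ).prev n = n - 1 := by
  rcases n with _ | n <;> simp

lemma Ch.exists_cycle (X : Ch) {n : ℕ} (x : X.X n) (hx : (X.d n (n + 1)).hom x = 0) :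
    ∃ c : X.cycles n, (X.iCycles n).hom c = x := by
  have hx' : x ∈ LinearMap.ker (X.sc n).g.hom := by
    change (X.d n ((ComplexShape.up ℕ).next n)).hom x = 0
    rw [Ch.next_eq]
    exact hx
  refine ⟨(X.sc n).moduleCatCyclesIso.inv.hom ⟨x, hx'⟩, ?_⟩
  exact congrArg (fun g => g.hom (⟨x, hx'⟩ : LinearMap.ker (X.sc n).g.hom))
    (X.sc n).moduleCatCyclesIso_inv_iCycles

lemma Ch.d_iCycles (X : Ch) (n m : ℕ) (c : X.cycles n) :
    (X.d n m).hom ((X.iCycles n).hom c) = 0 :=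
  congrArg (fun g => g.hom c) (X.iCycles_d n m)

lemma Ch.iCycles_injective (X : Ch) (n : ℕ) : Function.Injective (X.iCycles n).hom :=
  (ModuleCat.mono_iff_injective _).1 inferInstance

lemma Ch.homologyπ_surjective (X : Ch) (n : ℕ) : Function.Surjective (X.homologyπ n).hom :=
  (ModuleCat.epi_iff_surjective _).1 inferInstance

/-- The homology is the cokernel of `toCycles`, so the kernel of the projection is its image. -/
lemma Ch.homologyπ_eq_zero_iff (X : Ch) (n : ℕ) (c : X.cycles n) :
    (X.homologyπ n).hom c = 0 ↔ ∃ z, (X.d (n - 1) n).hom z = (X.iCycles n).hom c := by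
  have hex : (ShortComplex.mk (X.toCycles (n - 1) n) (X.homologyπ n) (by simp)).Exact :=
    ShortComplex.exact_of_g_is_cokernel _ (X.homologyIsCokernel (n - 1) n (Ch.prev_eq n))
  constructor
  · intro h
    obtain ⟨z, hz⟩ := (ShortComplex.moduleCat_exact_iff _).1 hex c h
    refine ⟨z, ?_⟩
    rw [← X.toCycles_i (n - 1) n]
    exact congrArg (X.iCycles n).hom hz
  · rintro ⟨z, hz⟩
    have : c = (X.toCycles (n - 1) n).hom z := by
      apply X.iCycles_injective n
      rw [← hz, ← X.toCycles_i (n - 1) n]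
      rfl
    rw [this]
    exact congrArg (fun g => g.hom z) (X.toCycles_comp_homologyπ (n - 1) n)

lemma Ch.homologyMap_apply {X Y : Ch} (f : X ⟶ Y) (n : ℕ) (c : X.cycles n) :
    (HomologicalComplex.homologyMap f n).hom ((X.homologyπ n).hom c) =
      (Y.homologyπ n).hom ((HomologicalComplex.cyclesMap f n).hom c) :=
  congrArg (fun g => g.hom c) (HomologicalComplex.homologyπ_naturality f n)

lemma Ch.iCycles_cyclesMap {X Y : Ch} (f : X ⟶ Y) (n : ℕ) (c : X.cycles n) :
    (Y.iCycles n).hom ((HomologicalComplex.cyclesMap f n).hom c) =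
      (f.f n).hom ((X.iCycles n).hom c) :=
  congrArg (fun g => g.hom c) (HomologicalComplex.cyclesMap_i f n)

/-- Quasi-isomorphisms in terms of cocycles and coboundaries. -/
lemma Ch.quasiIso_iff {X Y : Ch} (f : X ⟶ Y) :
    QuasiIso f ↔
      (∀ (n : ℕ) (x : X.X n), (X.d n (n + 1)).hom x = 0 →
        (∃ z, (Y.d (n - 1) n).hom z = (f.f n).hom x) → ∃ z, (X.d (n - 1) n).hom z = x) ∧
      (∀ (n : ℕ) (y : Y.X n), (Y.d n (n + 1)).hom y = 0 →
        ∃ x, (X.d n (n + 1)).hom x = 0 ∧ ∃ z, (Y.d (n - 1) n).hom z = y - (f.f n).hom x) := by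
  rw [_root_.quasiIso_iff, ← forall_and]
  refine forall_congr' fun n => ?_
  rw [quasiIsoAt_iff_isIso_homologyMap, ConcreteCategory.isIso_iff_bijective]
  change Function.Bijective (HomologicalComplex.homologyMap f n).hom ↔ _
  -- The two clauses are injectivity and surjectivity on cohomology.
  refine and_congr ?_ ?_
  · rw [injective_iff_map_eq_zero]
    constructor
    · rintro h x hx ⟨z, hz⟩
      obtain ⟨c, rfl⟩ := X.exists_cycle x hx
      rw [← Ch.homologyπ_eq_zero_iff]
      apply h
      rw [Ch.homologyMap_apply, Ch.homologyπ_eq_zero_iff]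
      exact ⟨z, by rw [hz, Ch.iCycles_cyclesMap]⟩
    · intro h a ha
      obtain ⟨c, rfl⟩ := X.homologyπ_surjective n a
      rw [Ch.homologyMap_apply, Ch.homologyπ_eq_zero_iff, Ch.iCycles_cyclesMap] at ha
      rw [Ch.homologyπ_eq_zero_iff]
      exact h _ (X.d_iCycles _ _ _) ha
  · constructor
    · intro h y hy
      obtain ⟨c, rfl⟩ := Y.exists_cycle y hy
      obtain ⟨a, ha⟩ := h ((Y.homologyπ n).hom c)
      obtain ⟨b, rfl⟩ := X.homologyπ_surjective n a
      refine ⟨_, X.d_iCycles _ _ b, ?_⟩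
      rw [Ch.homologyMap_apply] at ha
      rw [← Ch.iCycles_cyclesMap, ← map_sub, ← Ch.homologyπ_eq_zero_iff, map_sub, ha, sub_self]
    · intro h a
      obtain ⟨c, rfl⟩ := Y.homologyπ_surjective n a
      obtain ⟨x, hx, hz⟩ := h _ (Y.d_iCycles _ _ c)
      obtain ⟨b, rfl⟩ := X.exists_cycle x hx
      refine ⟨(X.homologyπ n).hom b, ?_⟩
      rw [← Ch.iCycles_cyclesMap, ← map_sub, ← Ch.homologyπ_eq_zero_iff, map_sub,
        sub_eq_zero] at hz
      rw [Ch.homologyMap_apply, hz]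

/-! ### Maps out of disks and spheres -/

/-- The sphere `Sᵏ` in degree `k`. -/
def sphereXIso (k : ℕ) : (S k).X k ≅ ModuleCat.of ℚ ℚ :=
  HomologicalComplex.singleObjXSelf (ComplexShape.up ℕ) k (ModuleCat.of ℚ ℚ)

/-- The disk `Dᵐ⁺¹` in degree `m`. -/
def diskXIso₀ (m : ℕ) : (D (m + 1)).X m ≅ ModuleCat.of ℚ ℚ :=
  HomologicalComplex.doubleXIso₀ (𝟙 (ModuleCat.of ℚ ℚ)) (rel_succ m)

/-- The disk `Dᵐ⁺¹` in degree `m + 1`. -/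
def diskXIso₁ (m : ℕ) : (D (m + 1)).X (m + 1) ≅ ModuleCat.of ℚ ℚ :=
  HomologicalComplex.doubleXIso₁ (𝟙 (ModuleCat.of ℚ ℚ)) (rel_succ m) (Nat.succ_ne_self m).symm

lemma disk_d (m : ℕ) :
    (D (m + 1)).d m (m + 1) = (diskXIso₀ m).hom ≫ (diskXIso₁ m).inv := by
  refine (HomologicalComplex.double_d _ (rel_succ m) (Nat.succ_ne_self m).symm).trans ?_
  rw [Category.id_comp]
  rfl

lemma SToD_f (m : ℕ) : (SToD (m + 1)).f (m + 1) = (sphereXIso (m + 1)).hom ≫ (diskXIso₁ m).inv := by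
  unfold SToD SToDSucc
  exact HomologicalComplex.mkHomFromSingle_f _ _

/-- The element that corresponds to a map out of a disk. -/
def diskVal {m : ℕ} {X : Ch} (g : D (m + 1) ⟶ X) : X.X m :=
  ((diskXIso₀ m).inv ≫ g.f m).hom (1 : ℚ)

lemma diskVal_comp {m : ℕ} {X Y : Ch} (g : D (m + 1) ⟶ X) (f : X ⟶ Y) :
    diskVal (g ≫ f) = (f.f m).hom (diskVal g) := rfl

/-- The maps out of a disk are the elements of the bottom degree. -/
def diskHomEquiv (m : ℕ) (X : Ch) : (D (m + 1) ⟶ X) ≃ X.X m :=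
  ((HomologicalComplex.evalCompCoyonedaCorepresentableByDoubleId (rel_succ m)
    (Nat.succ_ne_self m).symm (ModuleCat.of ℚ ℚ)).homEquiv (Y := X)).trans
    (ModuleCat.homEquiv.trans (LinearMap.ringLmapEquivSelf ℚ ℚ (X.X m)).toEquiv)

/-- Unfolded, `diskVal` is the underlying function of `diskHomEquiv`. -/
lemma diskVal_injective {m : ℕ} {X : Ch} :
    Function.Injective (diskVal : (D (m + 1) ⟶ X) → X.X m) := (diskHomEquiv m X).injective

lemma exists_diskVal {m : ℕ} {X : Ch} (z : X.X m) : ∃ g : D (m + 1) ⟶ X, diskVal g = z :=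
  (diskHomEquiv m X).surjective z

/-- The element that corresponds to a map out of a sphere. -/
def sphereVal {k : ℕ} {X : Ch} (g : S k ⟶ X) : X.X k :=
  ((sphereXIso k).inv ≫ g.f k).hom (1 : ℚ)

lemma sphereVal_injective {k : ℕ} {X : Ch} :
    Function.Injective (sphereVal : (S k ⟶ X) → X.X k) := by
  intro g g' h
  apply HomologicalComplex.from_single_hom_ext
  change g.f k = g'.f k
  rw [← cancel_epi (sphereXIso k).inv]
  ext
  exact h

lemma d_sphereVal {k : ℕ} {X : Ch} (g : S k ⟶ X) :
    (X.d k (k + 1)).hom (sphereVal g) = 0 := by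
  have h : g.f k ≫ X.d k (k + 1) = 0 := by
    rw [g.comm]
    change HomologicalComplex.d ((HomologicalComplex.single _ _ k).obj _) _ _ ≫ _ = 0
    rw [HomologicalComplex.single_obj_d]
    exact zero_comp
  exact congrArg (fun φ => φ.hom ((sphereXIso k).inv.hom (1 : ℚ))) h

lemma exists_sphereVal {k : ℕ} {X : Ch} (x : X.X k) (hx : (X.d k (k + 1)).hom x = 0) :
    ∃ g : S k ⟶ X, sphereVal g = x := by
  let φ : ModuleCat.of ℚ ℚ ⟶ X.X k := ModuleCat.ofHom (LinearMap.toSpanSingleton ℚ _ x)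
  let g : S k ⟶ X := HomologicalComplex.mkHomFromSingle φ (by
    rintro j rfl
    ext
    simp [φ, hx])
  have hg : g.f k = (sphereXIso k).hom ≫ φ := HomologicalComplex.mkHomFromSingle_f _ _
  refine ⟨g, ?_⟩
  unfold sphereVal
  rw [hg, Iso.inv_hom_id_assoc]
  simp [φ]

/-- The top class of the disk is the differential of its bottom class. Extending a map from the
sphere to the disk thus amounts to choosing a primitive of a cocycle. -/
lemma sphereVal_SToD_comp {m : ℕ} {X : Ch} (g : D (m + 1) ⟶ X) :
    sphereVal (SToD (m + 1) ≫ g) = (X.d m (m + 1)).hom (diskVal g) := by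
  have h : (sphereXIso (m + 1)).inv ≫ (SToD (m + 1) ≫ g).f (m + 1) =
      ((diskXIso₀ m).inv ≫ g.f m) ≫ X.d m (m + 1) := by
    rw [HomologicalComplex.comp_f, SToD_f, Category.assoc, Category.assoc, g.comm, disk_d]
    simp
  exact congrArg (fun φ => φ.hom (1 : ℚ)) h

lemma D_zero_hom_eq {X : Ch} (f g : D 0 ⟶ X) : f = g :=
  (isZero_zero Ch).eq_of_src f g

end IntervalSphere
end

noncomputable section
namespace IntervalSphere
attribute [-instance] CategoryTheory.catToReflQuiver

/-! ## Lifting properties of persistent complexes -/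

lemma lanPointUnit_desc {s : ℝ≥0} {K : Ch} {X : PCh} (φ : K ⟶ X.obj s) :
    lanPointUnit s K ≫ (lanPointDesc φ).app s = φ :=
  Functor.descOfIsLeftKanExtension_fac_app _
    ((Functor.fromPUnit s).leftKanExtensionUnit (Functor.fromPUnit K)) X
    { app := fun _ => φ
      naturality := fun _ _ _ => by simp } ⟨⟨⟩⟩

lemma lanPoint_hom_ext {s : ℝ≥0} {K : Ch} {X : PCh} {f g : lanPoint s K ⟶ X}
    (h : lanPointUnit s K ≫ f.app s = lanPointUnit s K ≫ g.app s) : f = g :=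
  Functor.hom_ext_of_isLeftKanExtension _
    ((Functor.fromPUnit s).leftKanExtensionUnit (Functor.fromPUnit K)) _ _ (by
      ext1
      ext1 ⟨⟨⟩⟩
      exact h)

/-- The universal element of the persistent disk. -/
def pDiskUnit (s : ℝ≥0) (k : ℕ) : D k ⟶ (pDisk s k).obj s := lanPointUnit s (D k)

/-- The morphism out of a persistent disk given by its value on the universal element. -/
def pDiskDesc {s : ℝ≥0} {k : ℕ} {X : PCh} (φ : D k ⟶ X.obj s) : pDisk s k ⟶ X := lanPointDesc φ

lemma pDiskUnit_desc {s : ℝ≥0} {k : ℕ} {X : PCh} (φ : D k ⟶ X.obj s) :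
    pDiskUnit s k ≫ (pDiskDesc φ).app s = φ := lanPointUnit_desc φ

lemma pDiskUnit_desc_assoc {s : ℝ≥0} {k : ℕ} {X : PCh} (φ : D k ⟶ X.obj s) {K : Ch}
    (g : X.obj s ⟶ K) : pDiskUnit s k ≫ (pDiskDesc φ).app s ≫ g = φ ≫ g := by
  rw [← Category.assoc, pDiskUnit_desc]

lemma pDisk_hom_ext {s : ℝ≥0} {k : ℕ} {X : PCh} {f g : pDisk s k ⟶ X}
    (h : pDiskUnit s k ≫ f.app s = pDiskUnit s k ≫ g.app s) : f = g := lanPoint_hom_ext h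

/-- The universal element of an infinite interval sphere. -/
def pSphereTopUnit (s : ℝ≥0) (k : ℕ) : S k ⟶ (pSphereTop s k).obj s := lanPointUnit s (S k)

/-- The morphism out of an infinite interval sphere given by its value on the universal
element. -/
def pSphereTopDesc {s : ℝ≥0} {k : ℕ} {X : PCh} (φ : S k ⟶ X.obj s) : pSphereTop s k ⟶ X :=
  lanPointDesc φ

lemma pSphereTopUnit_desc {s : ℝ≥0} {k : ℕ} {X : PCh} (φ : S k ⟶ X.obj s) :
    pSphereTopUnit s k ≫ (pSphereTopDesc φ).app s = φ := lanPointUnit_desc φ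

lemma pSphereTopUnit_desc_assoc {s : ℝ≥0} {k : ℕ} {X : PCh} (φ : S k ⟶ X.obj s) {K : Ch}
    (g : X.obj s ⟶ K) : pSphereTopUnit s k ≫ (pSphereTopDesc φ).app s ≫ g = φ ≫ g := by
  rw [← Category.assoc, pSphereTopUnit_desc]

lemma pSphereTop_hom_ext {s : ℝ≥0} {k : ℕ} {X : PCh} {f g : pSphereTop s k ⟶ X}
    (h : pSphereTopUnit s k ≫ f.app s = pSphereTopUnit s k ≫ g.app s) : f = g :=
  lanPoint_hom_ext h

lemma pDiskUnit_pDiskMap {s t : ℝ≥0} (h : s ≤ t) (k : ℕ) :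
    pDiskUnit t k ≫ (pDiskMap h k).app t = pDiskUnit s k ≫ (pDisk s k).map (homOfLE h) :=
  lanPointUnit_desc _

lemma pDiskUnit_pDiskMap_assoc {s t : ℝ≥0} (h : s ≤ t) (k : ℕ) {K : Ch}
    (g : (pDisk s k).obj t ⟶ K) :
    pDiskUnit t k ≫ (pDiskMap h k).app t ≫ g =
      pDiskUnit s k ≫ (pDisk s k).map (homOfLE h) ≫ g := by
  rw [← Category.assoc, pDiskUnit_pDiskMap, Category.assoc]

lemma pSphereTopUnit_toDisk (s : ℝ≥0) (k : ℕ) :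
    pSphereTopUnit s k ≫ (pSphereTopToDisk s k).app s = SToD k ≫ pDiskUnit s k :=
  lanPointUnit_desc _

lemma pSphereTopUnit_toDisk_assoc (s : ℝ≥0) (k : ℕ) {K : Ch} (g : (pDisk s k).obj s ⟶ K) :
    pSphereTopUnit s k ≫ (pSphereTopToDisk s k).app s ≫ g = SToD k ≫ pDiskUnit s k ≫ g := by
  rw [← Category.assoc, pSphereTopUnit_toDisk, Category.assoc]

section

variable {s t : ℝ≥0} (h : s < t) (k : ℕ)

/-- The unit of the finite interval sphere at its left end. -/
def pSphereUnit₀ : S k ⟶ (pSphere h k).obj s :=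
  ((ComposableArrows.mk₁ (homOfLE h.le)).leftKanExtensionUnit
    (ComposableArrows.mk₁ (SToD k))).app 0

/-- The unit of the finite interval sphere at its right end. -/
def pSphereUnit₁ : D k ⟶ (pSphere h k).obj t :=
  ((ComposableArrows.mk₁ (homOfLE h.le)).leftKanExtensionUnit
    (ComposableArrows.mk₁ (SToD k))).app 1

lemma pSphereUnit_naturality :
    pSphereUnit₀ h k ≫ (pSphere h k).map (homOfLE h.le) = SToD k ≫ pSphereUnit₁ h k :=
  (((ComposableArrows.mk₁ (homOfLE h.le)).leftKanExtensionUnit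
    (ComposableArrows.mk₁ (SToD k))).naturality (homOfLE (by simp) : (0 : Fin 2) ⟶ 1)).symm

lemma pSphereUnit_naturality_assoc {K : Ch} (g : (pSphere h k).obj t ⟶ K) :
    pSphereUnit₀ h k ≫ (pSphere h k).map (homOfLE h.le) ≫ g =
      SToD k ≫ pSphereUnit₁ h k ≫ g := by
  rw [← Category.assoc, pSphereUnit_naturality, Category.assoc]

variable {h k}

lemma pSphere_hom_ext {X : PCh} {f g : pSphere h k ⟶ X}
    (h₀ : pSphereUnit₀ h k ≫ f.app s = pSphereUnit₀ h k ≫ g.app s)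
    (h₁ : pSphereUnit₁ h k ≫ f.app t = pSphereUnit₁ h k ≫ g.app t) : f = g :=
  Functor.hom_ext_of_isLeftKanExtension _
    ((ComposableArrows.mk₁ (homOfLE h.le)).leftKanExtensionUnit
      (ComposableArrows.mk₁ (SToD k))) _ _ (ComposableArrows.hom_ext₁ h₀ h₁)

/-- The universal property of the Kan extension: the interval sphere carries a cocycle born at `s`
with a primitive given at `t`. -/
lemma exists_pSphere_hom {X : PCh} (a : S k ⟶ X.obj s) (b : D k ⟶ X.obj t)
    (hab : a ≫ X.map (homOfLE h.le) = SToD k ≫ b) :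
    ∃ f : pSphere h k ⟶ X, pSphereUnit₀ h k ≫ f.app s = a ∧ pSphereUnit₁ h k ≫ f.app t = b :=
  ⟨((ComposableArrows.mk₁ (homOfLE h.le)).leftKanExtension
      (ComposableArrows.mk₁ (SToD k))).descOfIsLeftKanExtension
    ((ComposableArrows.mk₁ (homOfLE h.le)).leftKanExtensionUnit (ComposableArrows.mk₁ (SToD k)))
    X (ComposableArrows.homMk₁ a b hab.symm),
    Functor.descOfIsLeftKanExtension_fac_app _ _ _ _ (0 : Fin 2),
    Functor.descOfIsLeftKanExtension_fac_app _ _ _ _ (1 : Fin 2)⟩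

lemma pSphereUnit₀_toDisk :
    pSphereUnit₀ h k ≫ (pSphereToDisk h k).app s = SToD k ≫ pDiskUnit s k :=
  Functor.descOfIsLeftKanExtension_fac_app _ _ _ _ (0 : Fin 2)

lemma pSphereUnit₀_toDisk_assoc {K : Ch} (g : (pDisk s k).obj s ⟶ K) :
    pSphereUnit₀ h k ≫ (pSphereToDisk h k).app s ≫ g = SToD k ≫ pDiskUnit s k ≫ g := by
  rw [← Category.assoc, pSphereUnit₀_toDisk, Category.assoc]

lemma pSphereUnit₁_toDisk :
    pSphereUnit₁ h k ≫ (pSphereToDisk h k).app t =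
      pDiskUnit s k ≫ (pDisk s k).map (homOfLE h.le) :=
  Functor.descOfIsLeftKanExtension_fac_app _ _ _ _ (1 : Fin 2)

lemma pSphereUnit₁_toDisk_assoc {K : Ch} (g : (pDisk s k).obj t ⟶ K) :
    pSphereUnit₁ h k ≫ (pSphereToDisk h k).app t ≫ g =
      pDiskUnit s k ≫ (pDisk s k).map (homOfLE h.le) ≫ g := by
  rw [← Category.assoc, pSphereUnit₁_toDisk, Category.assoc]

end

variable {X Y : PCh} (f : X ⟶ Y)

/-- A map out of `pDisk s k` is a map from `D k` to the value at `s`, so lifting problems of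
persistent complexes become problems in `Ch`. The next three criteria rest on the same translation.
-/
lemma hasLiftingProperty_zero_pDisk_iff (s : ℝ≥0) (k : ℕ) :
    HasLiftingProperty (0 : (0 : PCh) ⟶ pDisk s k) f ↔
      ∀ y : D k ⟶ Y.obj s, ∃ z : D k ⟶ X.obj s, z ≫ f.app s = y := by
  constructor
  · intro _ y
    have sq : CommSq (0 : (0 : PCh) ⟶ X) (0 : (0 : PCh) ⟶ pDisk s k) f (pDiskDesc y) :=
      ⟨(isZero_zero PCh).eq_of_src _ _⟩
    refine ⟨pDiskUnit s k ≫ sq.lift.app s, ?_⟩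
    rw [Category.assoc, ← NatTrans.comp_app, sq.fac_right, pDiskUnit_desc]
  · intro H
    refine ⟨fun {u v} sq => ⟨⟨?_⟩⟩⟩
    choose z hz using H (pDiskUnit s k ≫ v.app s)
    exact
      { l := pDiskDesc z
        fac_left := (isZero_zero PCh).eq_of_src _ _
        fac_right := pDisk_hom_ext (by
          rw [NatTrans.comp_app, pDiskUnit_desc_assoc, hz]) }

/-- The data `y`, `w` form a map from the disk to the pullback `Y(s) ×_{Y(t)} X(t)`, to be lifted to
`X(s)`. -/
lemma hasLiftingProperty_pDiskMap_iff {s t : ℝ≥0} (h : s ≤ t) (k : ℕ) :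
    HasLiftingProperty (pDiskMap h k) f ↔
      ∀ (y : D k ⟶ Y.obj s) (w : D k ⟶ X.obj t),
        w ≫ f.app t = y ≫ Y.map (homOfLE h) →
        ∃ z : D k ⟶ X.obj s, z ≫ f.app s = y ∧ z ≫ X.map (homOfLE h) = w := by
  constructor
  · intro _ y w hyw
    have sq : CommSq (pDiskDesc w) (pDiskMap h k) f (pDiskDesc y) := ⟨by
      refine pDisk_hom_ext ?_
      rw [NatTrans.comp_app, NatTrans.comp_app, pDiskUnit_desc_assoc, hyw,
        pDiskUnit_pDiskMap_assoc, NatTrans.naturality, pDiskUnit_desc_assoc]⟩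
    refine ⟨pDiskUnit s k ≫ sq.lift.app s, ?_, ?_⟩
    · rw [Category.assoc, ← NatTrans.comp_app, sq.fac_right, pDiskUnit_desc]
    · rw [Category.assoc, ← NatTrans.naturality, ← pDiskUnit_pDiskMap_assoc h,
        ← NatTrans.comp_app, sq.fac_left, pDiskUnit_desc]
  · intro H
    refine ⟨fun {u v} sq => ⟨⟨?_⟩⟩⟩
    choose z hz hz' using H (pDiskUnit s k ≫ v.app s) (pDiskUnit t k ≫ u.app t) (by
      rw [Category.assoc, Category.assoc, ← NatTrans.naturality, ← pDiskUnit_pDiskMap_assoc h,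
        ← NatTrans.comp_app, ← NatTrans.comp_app, sq.w])
    exact
      { l := pDiskDesc z
        fac_left := pDisk_hom_ext (by
          rw [NatTrans.comp_app, pDiskUnit_pDiskMap_assoc, NatTrans.naturality,
            pDiskUnit_desc_assoc, hz'])
        fac_right := pDisk_hom_ext (by
          rw [NatTrans.comp_app, pDiskUnit_desc_assoc, hz]) }

lemma hasLiftingProperty_pSphereTopToDisk_iff (s : ℝ≥0) (k : ℕ) :
    HasLiftingProperty (pSphereTopToDisk s k) f ↔
      ∀ (x : S k ⟶ X.obj s) (y : D k ⟶ Y.obj s), x ≫ f.app s = SToD k ≫ y →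
        ∃ z : D k ⟶ X.obj s, SToD k ≫ z = x ∧ z ≫ f.app s = y := by
  constructor
  · intro _ x y hxy
    have sq : CommSq (pSphereTopDesc x) (pSphereTopToDisk s k) f (pDiskDesc y) := ⟨by
      refine pSphereTop_hom_ext ?_
      rw [NatTrans.comp_app, NatTrans.comp_app, pSphereTopUnit_desc_assoc, hxy,
        pSphereTopUnit_toDisk_assoc, pDiskUnit_desc]⟩
    refine ⟨pDiskUnit s k ≫ sq.lift.app s, ?_, ?_⟩
    · rw [← pSphereTopUnit_toDisk_assoc, ← NatTrans.comp_app, sq.fac_left, pSphereTopUnit_desc]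
    · rw [Category.assoc, ← NatTrans.comp_app, sq.fac_right, pDiskUnit_desc]
  · intro H
    refine ⟨fun {u v} sq => ⟨⟨?_⟩⟩⟩
    choose z hz hz' using H (pSphereTopUnit s k ≫ u.app s) (pDiskUnit s k ≫ v.app s) (by
      rw [← pSphereTopUnit_toDisk_assoc, Category.assoc, ← NatTrans.comp_app,
        ← NatTrans.comp_app, sq.w])
    exact
      { l := pDiskDesc z
        fac_left := pSphereTop_hom_ext (by
          rw [NatTrans.comp_app, pSphereTopUnit_toDisk_assoc, pDiskUnit_desc, hz])
        fac_right := pDisk_hom_ext (by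
          rw [NatTrans.comp_app, pDiskUnit_desc_assoc, hz']) }

/-- The first hypothesis makes `x`, `w` a map out of the sphere; the other two are the commutativity
of the square at `s` and at `t`. -/
lemma hasLiftingProperty_pSphereToDisk_iff {s t : ℝ≥0} (h : s < t) (k : ℕ) :
    HasLiftingProperty (pSphereToDisk h k) f ↔
      ∀ (x : S k ⟶ X.obj s) (w : D k ⟶ X.obj t) (y : D k ⟶ Y.obj s),
        x ≫ X.map (homOfLE h.le) = SToD k ≫ w → x ≫ f.app s = SToD k ≫ y →
        w ≫ f.app t = y ≫ Y.map (homOfLE h.le) →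
        ∃ z : D k ⟶ X.obj s, SToD k ≫ z = x ∧ z ≫ X.map (homOfLE h.le) = w ∧
          z ≫ f.app s = y := by
  constructor
  · intro _ x w y hxw hxy hwy
    obtain ⟨u, hu₀, hu₁⟩ := exists_pSphere_hom x w hxw
    have sq : CommSq u (pSphereToDisk h k) f (pDiskDesc y) := ⟨by
      refine pSphere_hom_ext ?_ ?_
      · rw [NatTrans.comp_app, NatTrans.comp_app, ← Category.assoc, hu₀,
          pSphereUnit₀_toDisk_assoc, hxy, pDiskUnit_desc]
      · rw [NatTrans.comp_app, NatTrans.comp_app, ← Category.assoc, hu₁,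
          pSphereUnit₁_toDisk_assoc, hwy, NatTrans.naturality, pDiskUnit_desc_assoc]⟩
    refine ⟨pDiskUnit s k ≫ sq.lift.app s, ?_, ?_, ?_⟩
    · rw [← pSphereUnit₀_toDisk_assoc (h := h), ← NatTrans.comp_app, sq.fac_left, hu₀]
    · rw [Category.assoc, ← NatTrans.naturality, ← pSphereUnit₁_toDisk_assoc (h := h),
        ← NatTrans.comp_app, sq.fac_left, hu₁]
    · rw [Category.assoc, ← NatTrans.comp_app, sq.fac_right, pDiskUnit_desc]
  · intro H
    refine ⟨fun {u v} sq => ⟨⟨?_⟩⟩⟩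
    choose z hz hz' hz'' using H (pSphereUnit₀ h k ≫ u.app s) (pSphereUnit₁ h k ≫ u.app t)
      (pDiskUnit s k ≫ v.app s)
      (by rw [Category.assoc, ← u.naturality, pSphereUnit_naturality_assoc])
      (by rw [← pSphereUnit₀_toDisk_assoc (h := h), Category.assoc,
            ← NatTrans.comp_app, ← NatTrans.comp_app, sq.w])
      (by rw [Category.assoc, Category.assoc, ← NatTrans.naturality,
            ← pSphereUnit₁_toDisk_assoc (h := h), ← NatTrans.comp_app, ← NatTrans.comp_app, sq.w])
    exact
      { l := pDiskDesc z
        fac_left := pSphere_hom_ext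
          (by rw [NatTrans.comp_app, pSphereUnit₀_toDisk_assoc, pDiskUnit_desc, hz])
          (by rw [NatTrans.comp_app, pSphereUnit₁_toDisk_assoc, NatTrans.naturality,
                pDiskUnit_desc_assoc, hz'])
        fac_right := pDisk_hom_ext (by
          rw [NatTrans.comp_app, pDiskUnit_desc_assoc, hz'']) }

end IntervalSphere
end

noncomputable section
namespace IntervalSphere
attribute [-instance] CategoryTheory.catToReflQuiver

/-! ## Fibrations and trivial fibrations of persistent complexes in terms of elements -/

variable {X Y : PCh} (f : X ⟶ Y)

lemma PCh.app_map_apply {s t : ℝ≥0} (h : s ≤ t) (n : ℕ) (x : (X.obj s).X n) :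
    ((f.app t).f n).hom (((X.map (homOfLE h)).f n).hom x) =
      ((Y.map (homOfLE h)).f n).hom (((f.app s).f n).hom x) :=
  congrArg (fun g => (g.f n).hom x) (f.naturality (homOfLE h))

lemma genJ_rlp_iff :
    genJ.rlp f ↔
      (∀ (s : ℝ≥0) (n : ℕ) (y : (Y.obj s).X n), ∃ z, ((f.app s).f n).hom z = y) ∧
      ∀ (s t : ℝ≥0) (h : s < t) (n : ℕ) (y : (Y.obj s).X n) (w : (X.obj t).X n),
        ((f.app t).f n).hom w = ((Y.map (homOfLE h.le)).f n).hom y →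
        ∃ z, ((f.app s).f n).hom z = y ∧ ((X.map (homOfLE h.le)).f n).hom z = w := by
  constructor
  · intro hf
    refine ⟨fun s n y => ?_, fun s t h n y w hw => ?_⟩
    · obtain ⟨y, rfl⟩ := exists_diskVal y
      obtain ⟨z, rfl⟩ := (hasLiftingProperty_zero_pDisk_iff f s _).1 (hf _ (.infinite s (n + 1))) y
      exact ⟨diskVal z, rfl⟩
    · obtain ⟨y, rfl⟩ := exists_diskVal y
      obtain ⟨w, rfl⟩ := exists_diskVal w
      obtain ⟨z, rfl, rfl⟩ := (hasLiftingProperty_pDiskMap_iff f h.le _).1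
        (hf _ (.finite h (n + 1))) y w (diskVal_injective hw)
      exact ⟨diskVal z, rfl, rfl⟩
  · rintro ⟨H₁, H₂⟩ A B i hi
    cases hi with
    | @finite s t h k =>
      rw [hasLiftingProperty_pDiskMap_iff]
      intro y w hw
      -- Since `D 0` is zero, the generators with `k = 0` impose nothing.
      rcases k with _ | k
      · exact ⟨0, D_zero_hom_eq _ _, D_zero_hom_eq _ _⟩
      · obtain ⟨z, hz, hz'⟩ := H₂ s t h k (diskVal y) (diskVal w) (congrArg diskVal hw)
        obtain ⟨z, rfl⟩ := exists_diskVal z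
        exact ⟨z, diskVal_injective hz, diskVal_injective hz'⟩
    | infinite s k =>
      rw [hasLiftingProperty_zero_pDisk_iff]
      intro y
      rcases k with _ | k
      · exact ⟨0, D_zero_hom_eq _ _⟩
      · obtain ⟨z, hz⟩ := H₁ s k (diskVal y)
        obtain ⟨z, rfl⟩ := exists_diskVal z
        exact ⟨z, diskVal_injective hz⟩

lemma genI_rlp_iff :
    genI.rlp f ↔
      (∀ (s : ℝ≥0) (x : (X.obj s).X 0), ((X.obj s).d 0 1).hom x = 0 →
        ((f.app s).f 0).hom x = 0 → x = 0) ∧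
      (∀ (s : ℝ≥0) (n : ℕ) (x : (X.obj s).X (n + 1)) (y : (Y.obj s).X n),
        ((X.obj s).d (n + 1) (n + 1 + 1)).hom x = 0 →
        ((f.app s).f (n + 1)).hom x = ((Y.obj s).d n (n + 1)).hom y →
        ∃ z, ((X.obj s).d n (n + 1)).hom z = x ∧ ((f.app s).f n).hom z = y) ∧
      (∀ (s t : ℝ≥0) (h : s < t) (n : ℕ) (x : (X.obj s).X (n + 1)) (w : (X.obj t).X n)
        (y : (Y.obj s).X n), ((X.obj s).d (n + 1) (n + 1 + 1)).hom x = 0 →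
        ((X.map (homOfLE h.le)).f (n + 1)).hom x = ((X.obj t).d n (n + 1)).hom w →
        ((f.app s).f (n + 1)).hom x = ((Y.obj s).d n (n + 1)).hom y →
        ((f.app t).f n).hom w = ((Y.map (homOfLE h.le)).f n).hom y →
        ∃ z, ((X.obj s).d n (n + 1)).hom z = x ∧ ((X.map (homOfLE h.le)).f n).hom z = w ∧
          ((f.app s).f n).hom z = y) := by
  constructor
  · intro hf
    refine ⟨fun s x hx hfx => ?_, fun s n x y hx hxy => ?_,
      fun s t h n x w y hx hxw hxy hwy => ?_⟩
    · obtain ⟨x, rfl⟩ := exists_sphereVal x hx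
      obtain ⟨z, rfl, -⟩ := (hasLiftingProperty_pSphereTopToDisk_iff f s _).1
        (hf _ (.infinite s 0)) x 0 (sphereVal_injective (hfx.trans (by
          change 0 = sphereVal ((0 : S 0 ⟶ D 0) ≫ (0 : D 0 ⟶ Y.obj s))
          rw [zero_comp]
          rfl)))
      change sphereVal ((0 : S 0 ⟶ D 0) ≫ z) = 0
      rw [zero_comp]
      rfl
    · obtain ⟨x, rfl⟩ := exists_sphereVal x hx
      obtain ⟨y, rfl⟩ := exists_diskVal y
      obtain ⟨z, rfl, rfl⟩ := (hasLiftingProperty_pSphereTopToDisk_iff f s _).1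
        (hf _ (.infinite s (n + 1))) x y (sphereVal_injective (hxy.trans
          (sphereVal_SToD_comp y).symm))
      exact ⟨diskVal z, (sphereVal_SToD_comp z).symm, rfl⟩
    · obtain ⟨x, rfl⟩ := exists_sphereVal x hx
      obtain ⟨y, rfl⟩ := exists_diskVal y
      obtain ⟨w, rfl⟩ := exists_diskVal w
      obtain ⟨z, rfl, rfl, rfl⟩ := (hasLiftingProperty_pSphereToDisk_iff f h _).1
        (hf _ (.finite h (n + 1))) x w y (sphereVal_injective (hxw.trans
          (sphereVal_SToD_comp w).symm)) (sphereVal_injective (hxy.trans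
          (sphereVal_SToD_comp y).symm)) (diskVal_injective hwy)
      exact ⟨diskVal z, (sphereVal_SToD_comp z).symm, rfl, rfl⟩
  · rintro ⟨H₀, H₁, H₂⟩ A B i hi
    -- For `k = 0` the only possible lift is zero, so both families of 𝕀 follow from injectivity on
    -- cocycles of degree zero.
    have H₀' (s : ℝ≥0) (x : S 0 ⟶ X.obj s) (y : D 0 ⟶ Y.obj s)
        (hxy : x ≫ f.app s = SToD 0 ≫ y) : SToD 0 ≫ 0 = x := by
      rw [comp_zero]
      refine sphereVal_injective (H₀ s _ (d_sphereVal x) ?_).symm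
      change sphereVal (x ≫ f.app s) = 0
      rw [hxy, D_zero_hom_eq y 0, comp_zero]
      rfl
    cases hi with
    | @finite s t h k =>
      rw [hasLiftingProperty_pSphereToDisk_iff]
      intro x w y hxw hxy hwy
      rcases k with _ | k
      · exact ⟨0, H₀' s x y hxy, D_zero_hom_eq _ _, D_zero_hom_eq _ _⟩
      · obtain ⟨z, hz, hz', hz''⟩ := H₂ s t h k (sphereVal x) (diskVal w) (diskVal y)
          (d_sphereVal x) ((congrArg sphereVal hxw).trans (sphereVal_SToD_comp w))
          ((congrArg sphereVal hxy).trans (sphereVal_SToD_comp y)) (congrArg diskVal hwy)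
        obtain ⟨z, rfl⟩ := exists_diskVal z
        exact ⟨z, sphereVal_injective ((sphereVal_SToD_comp z).trans hz),
          diskVal_injective hz', diskVal_injective hz''⟩
    | infinite s k =>
      rw [hasLiftingProperty_pSphereTopToDisk_iff]
      intro x y hxy
      rcases k with _ | k
      · exact ⟨0, H₀' s x y hxy, D_zero_hom_eq _ _⟩
      · obtain ⟨z, hz, hz'⟩ := H₁ s k (sphereVal x) (diskVal y)
          (d_sphereVal x) ((congrArg sphereVal hxy).trans (sphereVal_SToD_comp y))
        obtain ⟨z, rfl⟩ := exists_diskVal z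
        exact ⟨z, sphereVal_injective ((sphereVal_SToD_comp z).trans hz), diskVal_injective hz'⟩

/-- The lifting property is used twice: one degree up it lifts `dy` (compatibly with `dw`) to a
cocycle `x`, and then it solves `dz = x` over `y` (and `w`). -/
lemma genI_rlp_le_genJ_rlp : genI.rlp ≤ genJ.rlp := by
  intro X Y f hf
  obtain ⟨-, H₁, H₂⟩ := (genI_rlp_iff f).1 hf
  refine (genJ_rlp_iff f).2 ⟨fun s n y => ?_, fun s t h n y w hw => ?_⟩
  · obtain ⟨x, hx, hxy⟩ := H₁ s (n + 1) 0 (((Y.obj s).d n (n + 1)).hom y) (map_zero _) (by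
      rw [map_zero, Ch.d_d_apply])
    obtain ⟨z, -, hz⟩ := H₁ s n x y hx hxy
    exact ⟨z, hz⟩
  · obtain ⟨x, hx, hxw, hxy⟩ := H₂ s t h (n + 1) 0 (((X.obj t).d n (n + 1)).hom w)
      (((Y.obj s).d n (n + 1)).hom y) (map_zero _) (by rw [map_zero, Ch.d_d_apply])
      (by rw [map_zero, Ch.d_d_apply]) (by rw [Ch.f_d_apply, hw, Ch.f_d_apply])
    obtain ⟨z, -, hz, hz'⟩ := H₂ s t h n x w y hx hxw hxy hw
    exact ⟨z, hz', hz⟩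

/-- Injectivity on cohomology is the lifting of primitives; surjectivity is the same with the
cocycle `0`, which lifts cocycles to cocycles. -/
lemma genI_rlp_le_pW : genI.rlp ≤ pW := by
  intro X Y f hf s
  obtain ⟨H₀, H₁, H₂⟩ := (genI_rlp_iff f).1 hf
  rw [Ch.quasiIso_iff]
  constructor
  · rintro (_ | n) x hx ⟨y, hy⟩
    · refine ⟨0, ?_⟩
      rw [map_zero, H₀ s x hx]
      rw [← hy]
      exact Ch.d_zero_left _ _
    · obtain ⟨z, hz, -⟩ := H₁ s n x y hx hy.symm
      exact ⟨z, hz⟩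
  · intro n y hy
    obtain ⟨x, hx, hxy⟩ := H₁ s n 0 y (map_zero _) (by rw [map_zero, hy])
    exact ⟨x, hx, 0, by rw [map_zero, hxy, sub_self]⟩

/-- A surjective quasi-isomorphism has the right lifting property for spheres in disks. -/
lemma Ch.exists_of_quasiIso_of_surjective {X Y : Ch} (f : X ⟶ Y) (hf : QuasiIso f)
    (hs : ∀ n, Function.Surjective (f.f n).hom) (n : ℕ) (x : X.X (n + 1)) (y : Y.X n)
    (hx : (X.d (n + 1) (n + 1 + 1)).hom x = 0)
    (hxy : (f.f (n + 1)).hom x = (Y.d n (n + 1)).hom y) :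
    ∃ z, (X.d n (n + 1)).hom z = x ∧ (f.f n).hom z = y := by
  rw [Ch.quasiIso_iff] at hf
  obtain ⟨z₀, hz₀⟩ : ∃ z, (X.d n (n + 1)).hom z = x := hf.1 (n + 1) x hx ⟨y, hxy.symm⟩
  obtain ⟨c, hc, v, hv⟩ := hf.2 n (y - (f.f n).hom z₀) (by
    rw [map_sub, ← Ch.f_d_apply, hz₀, hxy, sub_self])
  obtain ⟨u, rfl⟩ := hs (n - 1) v
  -- The primitive `z₀` of `x` is corrected first by a cocycle in the class of `y - f z₀`, then by
  -- the differential of a preimage of the remaining `v`.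
  refine ⟨z₀ + c + (X.d (n - 1) n).hom u, ?_, ?_⟩
  · rw [map_add, map_add, hc, Ch.d_d_apply, hz₀, add_zero, add_zero]
  · rw [map_add, map_add, Ch.f_d_apply, hv]
    abel

lemma Ch.eq_zero_of_quasiIso {X Y : Ch} (f : X ⟶ Y) (hf : QuasiIso f) (x : X.X 0)
    (hx : (X.d 0 1).hom x = 0) (hfx : (f.f 0).hom x = 0) : x = 0 := by
  rw [Ch.quasiIso_iff] at hf
  obtain ⟨z, rfl⟩ := hf.1 0 x hx ⟨0, by rw [map_zero, hfx]⟩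
  exact Ch.d_zero_left _ _

/-- The trivial fibrations of the interval-sphere model structure. -/
lemma genI_rlp_eq : genI.rlp = genJ.rlp ⊓ pW := by
  refine le_antisymm (le_inf genI_rlp_le_genJ_rlp genI_rlp_le_pW) ?_
  rintro X Y f ⟨hf, hw⟩
  obtain ⟨hs, hst⟩ := (genJ_rlp_iff f).1 hf
  have H₁ (s : ℝ≥0) := Ch.exists_of_quasiIso_of_surjective (f.app s) (hw s) (hs s)
  refine (genI_rlp_iff f).2 ⟨fun s => Ch.eq_zero_of_quasiIso _ (hw s), H₁, ?_⟩
  intro s t h n x w y hx hxw hxy hwy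
  -- Solve at `s` ignoring `w`. The error at `t` is a cocycle in the kernel of `f`: it is zero in
  -- degree `0`, and otherwise it is `du` with `f u = 0`.
  obtain ⟨z₀, hz₀, rfl⟩ := H₁ s n x y hx hxy
  have hd : ((X.obj t).d n (n + 1)).hom (((X.map (homOfLE h.le)).f n).hom z₀ - w) = 0 := by
    rw [map_sub, ← Ch.f_d_apply, hz₀, hxw, sub_self]
  have hf₀ : ((f.app t).f n).hom (((X.map (homOfLE h.le)).f n).hom z₀ - w) = 0 := by
    rw [map_sub, PCh.app_map_apply, hwy, sub_self]
  rcases n with _ | n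
  · exact ⟨z₀, hz₀, sub_eq_zero.1 (Ch.eq_zero_of_quasiIso _ (hw t) _ hd hf₀), rfl⟩
  · obtain ⟨u, hu, hfu⟩ := H₁ t n _ 0 hd (by rw [hf₀, map_zero])
    -- Lifting against 𝕁 over `0` moves `u` back to `s` inside the kernel; subtracting `d u'`
    -- repairs the value at `t` and changes neither the differential nor the image in `Y`.
    obtain ⟨u', hu', rfl⟩ := hst s t h n 0 u (by rw [hfu, map_zero])
    refine ⟨z₀ - ((X.obj s).d n (n + 1)).hom u', ?_, ?_, ?_⟩
    · rw [map_sub, Ch.d_d_apply, hz₀, sub_zero]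
    · rw [map_sub, Ch.f_d_apply, hu, sub_sub_cancel]
    · rw [map_sub, Ch.f_d_apply, hu', map_zero, sub_zero]

instance : pW.HasTwoOutOfThreeProperty where
  comp_mem f g hf hg s := by
    have := hf s
    have := hg s
    rw [NatTrans.comp_app]
    infer_instance
  of_postcomp f g hg hfg s := by
    have := hg s
    have : QuasiIso (f.app s ≫ g.app s) := hfg s
    exact quasiIso_of_comp_right _ (g.app s)
  of_precomp f g hf hfg s := by
    have := hf s
    have : QuasiIso (f.app s ≫ g.app s) := hfg s
    exact quasiIso_of_comp_left (f.app s) _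

end IntervalSphere
end

noncomputable section

/-! ### Strong generators along an adjunction; functor categories. -/

namespace CategoryTheory

/-- Strong generators are preserved by left adjoints of conservative faithful functors. -/
lemma Adjunction.isStrongGenerator_map {C D : Type*} [Category* C] [Category* D]
    {F : C ⥤ D} {G : D ⥤ C} (adj : F ⊣ G) [G.Faithful] [G.ReflectsIsomorphisms]
    {P : ObjectProperty C} (hP : P.IsStrongGenerator) : (P.strictMap F).IsStrongGenerator := by
  rw [ObjectProperty.isStrongGenerator_iff]
  constructor
  · intro X Y f g h
    apply G.map_injective
    refine hP.isSeparating _ _ fun K hK φ => ?_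
    apply (adj.homEquiv _ _).symm.injective
    rw [adj.homEquiv_naturality_right_symm, adj.homEquiv_naturality_right_symm]
    exact h _ (P.strictMap_obj F hK) _
  · intro X Y i _ h
    -- As a right adjoint, `G` preserves the monomorphism `i`, and the factorizations through `i`
    -- transpose to factorizations through `G.map i`.
    have := adj.isRightAdjoint
    have : IsIso (G.map i) := hP.isIso_of_mono _ fun K hK φ => by
      obtain ⟨ψ, hψ⟩ := h _ (P.strictMap_obj F hK) ((adj.homEquiv _ _).symm φ)
      refine ⟨adj.homEquiv _ _ ψ, (adj.homEquiv _ _).symm.injective ?_⟩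
      dsimp only at hψ ⊢
      rw [adj.homEquiv_naturality_right_symm, Equiv.symm_apply_apply, hψ]
    exact isIso_of_reflects_iso i G

/-- Replacing `J` by the equivalent `Jᵒᵖᵒᵖ` presents the functor category as presheaves on `Jᵒᵖ`. -/
lemma isLocallyPresentable_functor (J : Type) [SmallCategory J] (A : Type*) [Category.{0} A]
    [IsLocallyPresentable.{0} A] [HasPullbacks A] : IsLocallyPresentable.{0} (J ⥤ A) :=
  (opOpEquivalence J).congrLeft.isLocallyPresentable

end CategoryTheory

namespace IntervalSphere
attribute [-instance] CategoryTheory.catToReflQuiver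

/-! ## Local presentability -/

section

open Cardinal Opposite

attribute [local instance] fact_isRegular_aleph0

/-- The disk corepresents the degree `n` part, which commutes with filtered colimits. -/
instance (n : ℕ) : IsFinitelyPresentable.{0} (D (n + 1)) := by
  rw [isFinitelyPresentable_iff_preservesFilteredColimits]
  have : PreservesFilteredColimits
      (HomologicalComplex.eval (ModuleCat.{0} ℚ) (ComplexShape.up ℕ) n) :=
    ⟨fun J _ _ => inferInstance⟩
  have : PreservesFilteredColimits
      (HomologicalComplex.eval (ModuleCat.{0} ℚ) (ComplexShape.up ℕ) n ⋙
        forget (ModuleCat.{0} ℚ)) := ⟨fun J _ _ => inferInstance⟩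
  let e : coyoneda.obj (op (D (n + 1))) ≅
      HomologicalComplex.eval (ModuleCat.{0} ℚ) (ComplexShape.up ℕ) n ⋙
        forget (ModuleCat.{0} ℚ) :=
    NatIso.ofComponents (fun X => (diskHomEquiv n X).toIso) (fun f => rfl)
  exact ⟨fun J _ _ => preservesColimitsOfShape_of_natIso e.symm⟩

/-- The disks are a strong generator of the category of complexes. -/
lemma isStrongGenerator_disks :
    (ObjectProperty.ofObj fun n : ℕ => D (n + 1)).IsStrongGenerator := by
  rw [ObjectProperty.isStrongGenerator_iff]
  constructor
  · intro X Y f g h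
    ext n x
    obtain ⟨φ, rfl⟩ := exists_diskVal x
    exact congrArg diskVal (h _ (ObjectProperty.ofObj_apply _ n) φ)
  · intro X Y i _ h
    have (n : ℕ) : IsIso (i.f n) := by
      rw [ConcreteCategory.isIso_iff_bijective]
      refine ⟨(ModuleCat.mono_iff_injective (i.f n)).1 inferInstance, fun y => ?_⟩
      obtain ⟨φ, rfl⟩ := exists_diskVal y
      obtain ⟨ψ, rfl⟩ := h _ (ObjectProperty.ofObj_apply _ n) φ
      exact ⟨diskVal ψ, rfl⟩
    exact HomologicalComplex.Hom.isIso_of_components i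

instance : IsLocallyPresentable.{0} Ch where
  exists_cardinal := by
    refine ⟨ℵ₀, inferInstance, ?_⟩
    rw [IsCardinalLocallyPresentable.iff_exists_isStrongGenerator]
    refine ⟨_, inferInstance, isStrongGenerator_disks, ?_⟩
    rintro _ ⟨n⟩
    rw [isCardinalPresentable_iff]
    infer_instance

/-- Since `U` preserves filtered colimits, its left adjoint preserves finitely presentable objects;
so the free CDGAs on the disks are finitely presentable, and they remain a strong generator. -/
lemma CDGA.isLocallyPresentable [HasColimitsOfSize.{0, 0} CDGA] [CDGA.U.Faithful]
    [CDGA.U.ReflectsIsomorphisms] [PreservesFilteredColimits CDGA.U] :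
    IsLocallyPresentable.{0} CDGA where
  exists_cardinal := by
    refine ⟨ℵ₀, inferInstance, ?_⟩
    rw [IsCardinalLocallyPresentable.iff_exists_isStrongGenerator]
    have : CDGA.U.IsFinitelyAccessible :=
      Functor.isFinitelyAccessible_iff_preservesFilteredColimits.2 inferInstance
    refine ⟨_, inferInstance, CDGA.freeForget.isStrongGenerator_map isStrongGenerator_disks, ?_⟩
    rintro _ ⟨_, ⟨n⟩⟩
    rw [isCardinalPresentable_iff]
    exact CDGA.freeForget.isCardinalPresentable_leftAdjoint_obj ℵ₀ (D (n + 1))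

end

instance : IsLocallyPresentable.{0} PCh := isLocallyPresentable_functor _ _

end IntervalSphere
end

noncomputable section
namespace IntervalSphere
attribute [-instance] CategoryTheory.catToReflQuiver

namespace CDGA

/-! ## Limits of CDGAs -/

lemma comp_map {A B C : CDGA} (f : A ⟶ B) (g : B ⟶ C) : (f ≫ g).map = f.map ≫ g.map := rfl

lemma hom_ext' {A B : CDGA} {f g : A ⟶ B} (h : f.map = g.map) : f = g := Hom.ext h

instance : U.Faithful where
  map_injective h := hom_ext' h

/-- A bijective morphism of CDGAs is an isomorphism. -/
instance : U.ReflectsIsomorphisms where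
  reflects {A B} f hf := by
    let φ : A.X ⟶ B.X := f.map
    have : IsIso φ := hf
    have h₁ (n : ℕ) (x : A.X.X n) : ((inv φ).f n).hom ((φ.f n).hom x) = x :=
      congrArg (fun g => (g.f n).hom x) (IsIso.hom_inv_id φ)
    have h₂ (n : ℕ) (x : B.X.X n) : (φ.f n).hom (((inv φ).f n).hom x) = x :=
      congrArg (fun g => (g.f n).hom x) (IsIso.inv_hom_id φ)
    let g : B ⟶ A :=
      { map := inv φ
        map_one := by rw [← f.map_one]; exact h₁ _ _
        map_mul := fun {i j n} h a b => by
          obtain ⟨a, rfl⟩ : ∃ a', (φ.f i).hom a' = a := ⟨_, h₂ i a⟩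
          obtain ⟨b, rfl⟩ : ∃ b', (φ.f j).hom b' = b := ⟨_, h₂ j b⟩
          rw [h₁, h₁]
          exact (congrArg _ (f.map_mul h a b).symm).trans (h₁ _ _) }
    exact ⟨g, hom_ext' (IsIso.hom_inv_id φ), hom_ext' (IsIso.inv_hom_id φ)⟩

section Limits

variable {J : Type} [SmallCategory J] {F : J ⥤ CDGA} (c : Cone (F ⋙ U))

/-- The projections of a cone of complexes, in terms of elements. -/
def coneProj (j : J) (n : ℕ) : c.pt.X n →ₗ[ℚ] (F.obj j).X.X n := ((c.π.app j).f n).hom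

lemma coneProj_d (j : J) (m n : ℕ) (x : c.pt.X m) :
    coneProj c j n ((c.pt.d m n).hom x) = ((F.obj j).X.d m n).hom (coneProj c j m x) :=
  Ch.f_d_apply (c.π.app j) m n x

lemma map_coneProj {j k : J} (f : j ⟶ k) (n : ℕ) (x : c.pt.X n) :
    ((F.map f).map.f n).hom (coneProj c j n x) = coneProj c k n x :=
  congrArg (fun g => (g.f n).hom x) (c.w f)

variable {c} (hc : IsLimit c)

-- Elements of degree `n` are maps from `D (n + 1)`. Hence the limit property, tested on disks, says
-- that elements of the limit are exactly the compatible families; this lemma is uniqueness, the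
-- next one existence.
include hc in
lemma coneProj_ext {n : ℕ} {x y : c.pt.X n} (h : ∀ j, coneProj c j n x = coneProj c j n y) :
    x = y := by
  obtain ⟨x, rfl⟩ := exists_diskVal x
  obtain ⟨y, rfl⟩ := exists_diskVal y
  refine congrArg diskVal (hc.hom_ext fun j => diskVal_injective (h j))

include hc in
lemma exists_coneProj_eq {n : ℕ} (x : ∀ j, (F.obj j).X.X n)
    (hx : ∀ {j k : J} (f : j ⟶ k), ((F.map f).map.f n).hom (x j) = x k) :
    ∃ z, ∀ j, coneProj c j n z = x j := by
  choose φ hφ using fun j => exists_diskVal (x j)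
  let s : Cone (F ⋙ U) :=
    { pt := D (n + 1)
      π :=
        { app := φ
          naturality := fun j k f => by
            change 𝟙 _ ≫ φ k = φ j ≫ (F.map f).map
            rw [Category.id_comp]
            refine diskVal_injective ?_
            rw [diskVal_comp, hφ, hφ, hx] } }
  refine ⟨diskVal (hc.lift s), fun j => ?_⟩
  rw [← hφ]
  exact congrArg diskVal (hc.fac s j)

/-- The unit of a limit of CDGAs. -/
def limitOne : c.pt.X 0 :=
  (exists_coneProj_eq hc (fun j => (F.obj j).one) fun f => (F.map f).map_one).choose

lemma coneProj_limitOne (j : J) : coneProj c j 0 (limitOne hc) = (F.obj j).one :=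
  (exists_coneProj_eq hc (fun j => (F.obj j).one) fun f => (F.map f).map_one).choose_spec j

include hc in
lemma exists_limitMul {i j n : ℕ} (h : i + j = n) (a : c.pt.X i) (b : c.pt.X j) :
    ∃ z, ∀ l, coneProj c l n z = (F.obj l).mul h (coneProj c l i a) (coneProj c l j b) :=
  exists_coneProj_eq hc (fun l => (F.obj l).mul h (coneProj c l i a) (coneProj c l j b))
    fun f => by rw [(F.map f).map_mul, map_coneProj, map_coneProj]

/-- The product of two elements of a limit of CDGAs. -/
def limitMulFun {i j n : ℕ} (h : i + j = n) (a : c.pt.X i) (b : c.pt.X j) : c.pt.X n :=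
  (exists_limitMul hc h a b).choose

lemma coneProj_limitMulFun {i j n : ℕ} (h : i + j = n) (a : c.pt.X i) (b : c.pt.X j) (l : J) :
    coneProj c l n (limitMulFun hc h a b) =
      (F.obj l).mul h (coneProj c l i a) (coneProj c l j b) :=
  (exists_limitMul hc h a b).choose_spec l

/-- The multiplication of a limit of CDGAs. -/
def limitMul {i j n : ℕ} (h : i + j = n) : c.pt.X i →ₗ[ℚ] c.pt.X j →ₗ[ℚ] c.pt.X n :=
  LinearMap.mk₂ ℚ (limitMulFun hc h)
    (fun a a' b => coneProj_ext hc fun l => by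
      simp only [map_add, coneProj_limitMulFun, LinearMap.add_apply])
    (fun q a b => coneProj_ext hc fun l => by
      simp only [map_smul, coneProj_limitMulFun, LinearMap.smul_apply])
    (fun a b b' => coneProj_ext hc fun l => by
      simp only [map_add, coneProj_limitMulFun])
    (fun q a b => coneProj_ext hc fun l => by
      simp only [map_smul, coneProj_limitMulFun])

lemma coneProj_limitMul {i j n : ℕ} (h : i + j = n) (a : c.pt.X i) (b : c.pt.X j) (l : J) :
    coneProj c l n (limitMul hc h a b) = (F.obj l).mul h (coneProj c l i a) (coneProj c l j b) :=
  coneProj_limitMulFun hc h a b l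

/-- The limit of a diagram of CDGAs. -/
def limitObj : CDGA where
  X := c.pt
  one := limitOne hc
  mul := limitMul hc
  one_mul h a := coneProj_ext hc fun l => by
    rw [coneProj_limitMul, coneProj_limitOne, CDGA.one_mul]
  mul_one h a := coneProj_ext hc fun l => by
    rw [coneProj_limitMul, coneProj_limitOne, CDGA.mul_one]
  mul_assoc hij hjk h h' a b c := coneProj_ext hc fun l => by
    simp only [coneProj_limitMul]
    exact CDGA.mul_assoc _ _ _ _ _ _ _ _
  mul_comm h h' a b := coneProj_ext hc fun l => by
    simp only [coneProj_limitMul, map_smul]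
    exact CDGA.mul_comm _ _ _ _ _
  leibniz h h₁ h₂ a b := coneProj_ext hc fun l => by
    simp only [coneProj_limitMul, coneProj_d, map_smul, map_add]
    exact CDGA.leibniz _ _ _ _ _ _

/-- The limit cone of CDGAs. -/
def limitCone : Cone F where
  pt := limitObj hc
  π :=
    { app := fun j =>
        { map := c.π.app j
          map_one := coneProj_limitOne hc j
          map_mul := fun h a b => coneProj_limitMul hc h a b j }
      naturality := fun _ _ f => hom_ext' (c.π.naturality f) }

/-- The limit cone of CDGAs is a limit. -/
def isLimitLimitCone : IsLimit (limitCone hc) where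
  lift s :=
    { map := hc.lift (U.mapCone s)
      map_one := coneProj_ext hc fun j => by
        refine Eq.trans ?_ (coneProj_limitOne hc j).symm
        refine Eq.trans ?_ (s.π.app j).map_one
        exact congrArg (fun g => (g.f 0).hom s.pt.one) (hc.fac (U.mapCone s) j)
      map_mul := fun {p q n} h a b => coneProj_ext hc fun j => by
        have H (m : ℕ) (x : s.pt.X.X m) :
            coneProj c j m (((hc.lift (U.mapCone s)).f m).hom x) =
              (((s.π.app j).map).f m).hom x :=
          congrArg (fun g => (g.f m).hom x) (hc.fac (U.mapCone s) j)
        refine Eq.trans (H _ _) ?_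
        refine Eq.trans ((s.π.app j).map_mul h a b) ?_
        refine Eq.trans ?_ (coneProj_limitMul hc h _ _ j).symm
        exact (congrArg₂ (fun x y => (F.obj j).mul h x y) (H _ _) (H _ _)).symm }
  fac s j := hom_ext' (hc.fac (U.mapCone s) j)
  uniq s m hm := hom_ext' (hc.uniq (U.mapCone s) m.map fun j => congrArg Hom.map (hm j))

end Limits

instance : HasLimits CDGA where
  has_limits_of_shape _ _ :=
    ⟨fun F => ⟨⟨⟨limitCone (limit.isLimit (F ⋙ U)), isLimitLimitCone _⟩⟩⟩⟩

end CDGA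

end IntervalSphere
end

noncomputable section
namespace IntervalSphere
attribute [-instance] CategoryTheory.catToReflQuiver

namespace CDGA

/-! ## Quotients and colimits of CDGAs -/

section Quotient

variable {A : CDGA} (R : ∀ n : ℕ, A.X.X n → Prop)

/-- The differential graded ideal generated by a family of elements. -/
inductive IdealGen : ∀ n : ℕ, A.X.X n → Prop
  | of {n} {x : A.X.X n} (hx : R n x) : IdealGen n x
  | zero (n) : IdealGen n 0
  | add {n} {x y : A.X.X n} : IdealGen n x → IdealGen n y → IdealGen n (x + y)
  | smul {n} (q : ℚ) {x : A.X.X n} : IdealGen n x → IdealGen n (q • x)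
  | mul {i j n} (h : i + j = n) (a : A.X.X i) {x : A.X.X j} :
      IdealGen j x → IdealGen n (A.mul h a x)
  | d {n} {x : A.X.X n} : IdealGen n x → IdealGen (n + 1) ((A.X.d n (n + 1)).hom x)

/-- The differential graded ideal generated by a family of elements, in each degree. -/
def ideal (n : ℕ) : Submodule ℚ (A.X.X n) where
  carrier := {x | IdealGen R n x}
  zero_mem' := .zero n
  add_mem' := .add
  smul_mem' q _ := .smul q

lemma mul_mem_ideal_right {i j n : ℕ} (h : i + j = n) (a : A.X.X i) {x : A.X.X j}
    (hx : x ∈ ideal R j) : A.mul h a x ∈ ideal R n := IdealGen.mul h a hx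

/-- Up to a sign, graded commutativity turns right multiples into left ones, so `IdealGen` only
needs closure on one side. -/
lemma mul_mem_ideal_left {i j n : ℕ} (h : i + j = n) {x : A.X.X i} (a : A.X.X j)
    (hx : x ∈ ideal R i) : A.mul h x a ∈ ideal R n := by
  rw [A.mul_comm h (by omega)]
  exact (ideal R n).smul_mem _ (mul_mem_ideal_right R _ a hx)

lemma d_mem_ideal {n : ℕ} {x : A.X.X n} (hx : x ∈ ideal R n) :
    (A.X.d n (n + 1)).hom x ∈ ideal R (n + 1) := IdealGen.d hx

/-- The degree `n` part of the quotient by a differential graded ideal. -/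
abbrev QuotPart (n : ℕ) : Type := A.X.X n ⧸ ideal R n

/-- The differential of the quotient by a differential graded ideal. -/
def quotD (n : ℕ) : QuotPart R n →ₗ[ℚ] QuotPart R (n + 1) :=
  (ideal R n).mapQ (ideal R (n + 1)) (A.X.d n (n + 1)).hom fun _ hx => d_mem_ideal R hx

/-- The multiplication of the quotient by a differential graded ideal. -/
def quotMul {i j n : ℕ} (h : i + j = n) :
    QuotPart R i →ₗ[ℚ] QuotPart R j →ₗ[ℚ] QuotPart R n :=
  (ideal R i).liftQ
    ((ideal R j).liftQ ((A.mul h).compr₂ (ideal R n).mkQ).flip fun x hx => by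
      ext a
      simpa using mul_mem_ideal_right R h a hx).flip
    fun x hx => by
      ext a
      exact (Submodule.Quotient.mk_eq_zero _).2 (mul_mem_ideal_left R h a hx)

lemma quotD_mk {n : ℕ} (a : A.X.X n) :
    quotD R n ((ideal R n).mkQ a) = (ideal R (n + 1)).mkQ ((A.X.d n (n + 1)).hom a) := rfl

/-- The underlying complex of the quotient by a differential graded ideal. -/
def quotComplex : Ch :=
  CochainComplex.of (fun n => ModuleCat.of ℚ (QuotPart R n))
    (fun n => ModuleCat.ofHom (quotD R n))
    (fun n => by
      ext a
      change quotD R (n + 1) (quotD R n ((ideal R n).mkQ a)) = 0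
      rw [quotD_mk, quotD_mk, Ch.d_d_apply, map_zero])

lemma quotComplex_d (n : ℕ) :
    (quotComplex R).d n (n + 1) = ModuleCat.ofHom (quotD R n) :=
  CochainComplex.of_d (fun n => ModuleCat.of ℚ (QuotPart R n))
    (fun n => ModuleCat.ofHom (quotD R n)) n

/-- The quotient of a CDGA by the differential graded ideal generated by a family of elements. -/
def quotObj : CDGA where
  X := quotComplex R
  one := (ideal R 0).mkQ A.one
  mul h := quotMul R h
  one_mul := by
    intro n h a
    obtain ⟨a, rfl⟩ := (ideal R n).mkQ_surjective a
    exact congrArg (ideal R n).mkQ (A.one_mul h a)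
  mul_one := by
    intro n h a
    obtain ⟨a, rfl⟩ := (ideal R n).mkQ_surjective a
    exact congrArg (ideal R n).mkQ (A.mul_one h a)
  mul_assoc := by
    intro i j k ij jk n hij hjk h h' a b c
    obtain ⟨a, rfl⟩ := (ideal R _).mkQ_surjective a
    obtain ⟨b, rfl⟩ := (ideal R _).mkQ_surjective b
    obtain ⟨c, rfl⟩ := (ideal R _).mkQ_surjective c
    exact congrArg (ideal R n).mkQ (A.mul_assoc hij hjk h h' a b c)
  mul_comm := by
    intro i j n h h' a b
    obtain ⟨a, rfl⟩ := (ideal R _).mkQ_surjective a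
    obtain ⟨b, rfl⟩ := (ideal R _).mkQ_surjective b
    exact congrArg (ideal R n).mkQ (A.mul_comm h h' a b)
  leibniz := by
    intro i j n h h₁ h₂ a b
    obtain ⟨a, rfl⟩ := (ideal R _).mkQ_surjective a
    obtain ⟨b, rfl⟩ := (ideal R _).mkQ_surjective b
    rw [quotComplex_d, quotComplex_d, quotComplex_d]
    exact congrArg (ideal R (n + 1)).mkQ (A.leibniz h h₁ h₂ a b)

/-- The quotient morphism. -/
def quotMk : A ⟶ quotObj R where
  map :=
    { f := fun n => ModuleCat.ofHom (Y := QuotPart R n) (ideal R n).mkQ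
      comm' := by
        rintro i _ rfl
        change _ ≫ (quotComplex R).d i (i + 1) = _
        rw [quotComplex_d]
        rfl }
  map_one := rfl
  map_mul := fun _ _ _ => rfl

lemma quotMk_surjective (n : ℕ) : Function.Surjective ((quotMk R).map.f n).hom :=
  (ideal R n).mkQ_surjective

lemma quotMk_eq_zero {n : ℕ} {x : A.X.X n} (hx : R n x) : ((quotMk R).map.f n).hom x = 0 :=
  (Submodule.Quotient.mk_eq_zero (ideal R n)).2 (IdealGen.of hx)

variable {R}

lemma quot_hom_ext {B : CDGA} {f g : quotObj R ⟶ B} (h : quotMk R ≫ f = quotMk R ≫ g) :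
    f = g := by
  refine hom_ext' ?_
  ext n x
  obtain ⟨x, rfl⟩ := quotMk_surjective R n x
  exact congrArg (fun φ : A ⟶ B => (φ.map.f n).hom x) h

variable {B : CDGA} (f : A ⟶ B) (hf : ∀ n x, R n x → (f.map.f n).hom x = 0)

include hf in
lemma map_eq_zero_of_mem_ideal {n : ℕ} {x : A.X.X n} (hx : x ∈ ideal R n) :
    (f.map.f n).hom x = 0 := by
  change IdealGen R n x at hx
  induction hx with
  | of hx => exact hf _ _ hx
  | zero n => exact map_zero _
  | add _ _ h h' => rw [map_add, h, h', add_zero]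
  | smul q _ h => rw [map_smul, h, smul_zero]
  | mul h a _ h' => rw [f.map_mul, h', map_zero]
  | d _ h => rw [Ch.f_d_apply, h, map_zero]

/-- The morphism out of a quotient. -/
def quotDesc : quotObj R ⟶ B where
  map :=
    { f := fun n => ModuleCat.ofHom (X := QuotPart R n)
        ((ideal R n).liftQ (f.map.f n).hom fun _ hx => map_eq_zero_of_mem_ideal f hf hx)
      comm' := by
        rintro i _ rfl
        change _ = (quotComplex R).d i (i + 1) ≫ _
        rw [quotComplex_d]
        ext a
        obtain ⟨a, rfl⟩ := (ideal R i).mkQ_surjective a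
        exact (Ch.f_d_apply f.map i (i + 1) a).symm }
  map_one := f.map_one
  map_mul := by
    intro i j n h a b
    obtain ⟨a, rfl⟩ := (ideal R i).mkQ_surjective a
    obtain ⟨b, rfl⟩ := (ideal R j).mkQ_surjective b
    exact f.map_mul h a b

lemma quotMk_desc : quotMk R ≫ quotDesc f hf = f := hom_ext' (by ext n x; rfl)

end Quotient

section Colimits

variable {J : Type} [SmallCategory J] (F : J ⥤ CDGA)

/-- The inclusion of a term of a diagram into the free CDGA on the colimit of complexes. -/
def preColimitι (j : J) : (F.obj j).X ⟶ (freeObj (colimit (F ⋙ U))).X :=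
  colimit.ι (F ⋙ U) j ≫ freeUnit _

/-- The relations that define the colimit of a diagram of CDGAs. -/
inductive ColimitRel : ∀ n : ℕ, (freeObj (colimit (F ⋙ U))).X.X n → Prop
  | one (j : J) :
      ColimitRel 0 (((preColimitι F j).f 0).hom (F.obj j).one - (freeObj (colimit (F ⋙ U))).one)
  | mul (j : J) {p q n : ℕ} (h : p + q = n) (a : (F.obj j).X.X p) (b : (F.obj j).X.X q) :
      ColimitRel n (((preColimitι F j).f n).hom ((F.obj j).mul h a b) -
        (freeObj (colimit (F ⋙ U))).mul h (((preColimitι F j).f p).hom a)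
          (((preColimitι F j).f q).hom b))

/-- The inclusion of a term of a diagram into its colimit. -/
def colimitι (j : J) : F.obj j ⟶ quotObj (ColimitRel F) where
  map := preColimitι F j ≫ (quotMk (ColimitRel F)).map
  map_one := by
    rw [← (quotMk (ColimitRel F)).map_one, Ch.comp_f_apply, ← sub_eq_zero, ← map_sub]
    exact quotMk_eq_zero _ (.one j)
  map_mul h a b := by
    rw [Ch.comp_f_apply, Ch.comp_f_apply, Ch.comp_f_apply, ← (quotMk (ColimitRel F)).map_mul,
      ← sub_eq_zero, ← map_sub]
    exact quotMk_eq_zero _ (.mul j h a b)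

/-- The colimit cocone of a diagram of CDGAs. -/
def colimitCocone : Cocone F where
  pt := quotObj (ColimitRel F)
  ι :=
    { app := colimitι F
      naturality := fun j k f => hom_ext' (by
        change (F.map f).map ≫ (colimit.ι (F ⋙ U) k ≫ _) ≫ _ =
          ((colimit.ι (F ⋙ U) j ≫ _) ≫ _) ≫ 𝟙 _
        rw [← colimit.w (F ⋙ U) f]
        simp only [Category.assoc, Category.comp_id]
        rfl) }

variable {F}

lemma preColimitι_freeLift (s : Cocone F) (j : J) :
    preColimitι F j ≫ (freeLift (A := s.pt) (colimit.desc (F ⋙ U) (U.mapCocone s))).map =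
      (s.ι.app j).map := by
  refine (Category.assoc _ _ _).trans ?_
  refine (congrArg _ (freeLift_unit (A := s.pt) _)).trans ?_
  exact colimit.ι_desc (U.mapCocone s) j

/-- The morphism out of the colimit of a diagram of CDGAs. -/
def colimitDesc (s : Cocone F) : quotObj (ColimitRel F) ⟶ s.pt :=
  quotDesc (freeLift (A := s.pt) (colimit.desc (F ⋙ U) (U.mapCocone s))) (by
    have H (j : J) (n : ℕ) (x : (F.obj j).X.X n) := congrArg (fun g => (g.f n).hom x)
      (preColimitι_freeLift s j)
    simp only [Ch.comp_f_apply] at H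
    intro n x hx
    cases hx with
    | one j =>
      rw [map_sub, sub_eq_zero, Hom.map_one, H]
      exact (s.ι.app j).map_one
    | mul j h a b =>
      rw [map_sub, sub_eq_zero, Hom.map_mul, H, H, H]
      exact (s.ι.app j).map_mul h a b)

/-- The colimit cocone of a diagram of CDGAs is a colimit. -/
def isColimitColimitCocone : IsColimit (colimitCocone F) where
  desc s := colimitDesc s
  fac s j := hom_ext' (by
    change (preColimitι F j ≫ (quotMk (ColimitRel F)).map) ≫ (colimitDesc s).map = _
    rw [Category.assoc, ← comp_map, colimitDesc, quotMk_desc, preColimitι_freeLift])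
  uniq s m hm := by
    refine quot_hom_ext ?_
    rw [colimitDesc, quotMk_desc]
    refine (freeHomEquiv _ _).injective ?_
    refine Eq.trans ?_ (freeLift_unit (A := s.pt) _).symm
    refine colimit.hom_ext fun j => ?_
    rw [colimit.ι_desc]
    refine Eq.trans ?_ (congrArg Hom.map (hm j))
    exact (Category.assoc _ _ _).symm

end Colimits

/-- The colimit of the underlying complexes already accounts for linearity, differentials and
transition maps, so only the relations making the inclusions unital and multiplicative have to be
imposed on its free CDGA. -/
instance : HasColimits CDGA where
  has_colimits_of_shape _ _ :=
    ⟨fun F => ⟨⟨⟨colimitCocone F, isColimitColimitCocone⟩⟩⟩⟩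

end CDGA

end IntervalSphere
end

noncomputable section
namespace IntervalSphere
attribute [-instance] CategoryTheory.catToReflQuiver

namespace CDGA

/-! ## Filtered colimits of CDGAs -/

section Filtered

variable {J : Type} [SmallCategory J] {F : J ⥤ CDGA} (c : Cocone (F ⋙ U))

/-- The inclusions of a cocone of complexes, in terms of elements. -/
def coconeIncl (j : J) (n : ℕ) : (F.obj j).X.X n →ₗ[ℚ] c.pt.X n := ((c.ι.app j).f n).hom

/-- The transition maps of a diagram of CDGAs, in terms of elements. -/
def trans {j k : J} (f : j ⟶ k) (n : ℕ) : (F.obj j).X.X n →ₗ[ℚ] (F.obj k).X.X n :=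
  ((F.map f).map.f n).hom

lemma coconeIncl_d (j : J) (m n : ℕ) (x : (F.obj j).X.X m) :
    coconeIncl c j n (((F.obj j).X.d m n).hom x) = (c.pt.d m n).hom (coconeIncl c j m x) :=
  Ch.f_d_apply (c.ι.app j) m n x

lemma coconeIncl_trans {j k : J} (f : j ⟶ k) (n : ℕ) (x : (F.obj j).X.X n) :
    coconeIncl c k n (trans f n x) = coconeIncl c j n x :=
  congrArg (fun g => (g.f n).hom x) (c.w f)

lemma trans_mul {j k : J} (f : j ⟶ k) {p q n : ℕ} (h : p + q = n) (a : (F.obj j).X.X p)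
    (b : (F.obj j).X.X q) :
    trans f n ((F.obj j).mul h a b) = (F.obj k).mul h (trans f p a) (trans f q b) :=
  (F.map f).map_mul h a b

lemma trans_one {j k : J} (f : j ⟶ k) : trans f 0 (F.obj j).one = (F.obj k).one :=
  (F.map f).map_one

lemma trans_comp {j k l : J} (f : j ⟶ k) (g : k ⟶ l) (n : ℕ) (x : (F.obj j).X.X n) :
    trans (F := F) (f ≫ g) n x = trans g n (trans f n x) := by
  unfold trans
  rw [F.map_comp]
  rfl

variable [IsFiltered J] {c} (hc : IsColimit c)

-- A map from the finitely presentable disk to a filtered colimit factors through a stage; the next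
-- lemma is the matching uniqueness.
include hc in
lemma exists_coconeIncl {n : ℕ} (x : c.pt.X n) :
    ∃ (j : J) (a : (F.obj j).X.X n), coconeIncl c j n a = x := by
  obtain ⟨φ, rfl⟩ := exists_diskVal x
  obtain ⟨j, p, rfl⟩ := IsFinitelyPresentable.exists_hom_of_isColimit hc φ
  exact ⟨j, diskVal (X := (F.obj j).X) p, rfl⟩

include hc in
lemma exists_trans_eq {j : J} {n : ℕ} {a b : (F.obj j).X.X n}
    (h : coconeIncl c j n a = coconeIncl c j n b) :
    ∃ (k : J) (f : j ⟶ k), trans f n a = trans f n b := by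
  obtain ⟨φ, rfl⟩ := exists_diskVal a
  obtain ⟨ψ, rfl⟩ := exists_diskVal b
  obtain ⟨k, u, v, huv⟩ := IsFinitelyPresentable.exists_eq_of_isColimit hc (X := D (n + 1))
    (i := j) (j := j) φ ψ (diskVal_injective h)
  refine ⟨IsFiltered.coeq u v, u ≫ IsFiltered.coeqHom u v, ?_⟩
  rw [trans_comp, IsFiltered.coeq_condition, trans_comp]
  exact congrArg _ (congrArg diskVal huv)

include hc in
lemma exists_coconeIncl₂ {m n : ℕ} (x : c.pt.X m) (y : c.pt.X n) :
    ∃ (j : J) (a : (F.obj j).X.X m) (b : (F.obj j).X.X n),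
      coconeIncl c j m a = x ∧ coconeIncl c j n b = y := by
  obtain ⟨j, a, rfl⟩ := exists_coconeIncl hc x
  obtain ⟨k, b, rfl⟩ := exists_coconeIncl hc y
  exact ⟨IsFiltered.max j k, trans (IsFiltered.leftToMax j k) m a,
    trans (IsFiltered.rightToMax j k) n b, coconeIncl_trans c _ _ _, coconeIncl_trans c _ _ _⟩

include hc in
lemma exists_coconeIncl₃ {l m n : ℕ} (x : c.pt.X l) (y : c.pt.X m) (z : c.pt.X n) :
    ∃ (j : J) (a : (F.obj j).X.X l) (b : (F.obj j).X.X m) (b' : (F.obj j).X.X n),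
      coconeIncl c j l a = x ∧ coconeIncl c j m b = y ∧ coconeIncl c j n b' = z := by
  obtain ⟨j, a, b, rfl, rfl⟩ := exists_coconeIncl₂ hc x y
  obtain ⟨k, b', rfl⟩ := exists_coconeIncl hc z
  exact ⟨IsFiltered.max j k, trans (IsFiltered.leftToMax j k) l a,
    trans (IsFiltered.leftToMax j k) m b, trans (IsFiltered.rightToMax j k) n b',
    coconeIncl_trans c _ _ _, coconeIncl_trans c _ _ _, coconeIncl_trans c _ _ _⟩

-- Go to a stage where `a` and `a'` agree, then further to one where `b` and `b'` agree too. This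
-- makes the product in the colimit independent of representatives.
include hc in
lemma coconeIncl_mul_eq_of_eq {j : J} {p q n : ℕ} (h : p + q = n) {a a' : (F.obj j).X.X p}
    {b b' : (F.obj j).X.X q} (ha : coconeIncl c j p a = coconeIncl c j p a')
    (hb : coconeIncl c j q b = coconeIncl c j q b') :
    coconeIncl c j n ((F.obj j).mul h a b) = coconeIncl c j n ((F.obj j).mul h a' b') := by
  obtain ⟨k, u, hu⟩ := exists_trans_eq hc ha
  rw [← coconeIncl_trans c u, ← coconeIncl_trans c u _ b'] at hb
  obtain ⟨l, v, hv⟩ := exists_trans_eq hc hb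
  rw [← coconeIncl_trans c (u ≫ v), ← coconeIncl_trans c (u ≫ v) n ((F.obj j).mul h a' b'),
    trans_mul, trans_mul, trans_comp, trans_comp, trans_comp, trans_comp, hu, hv]

include hc in
lemma exists_colimitMul {p q n : ℕ} (h : p + q = n) (x : c.pt.X p) (y : c.pt.X q) :
    ∃ z, ∀ (j : J) (a : (F.obj j).X.X p) (b : (F.obj j).X.X q), coconeIncl c j p a = x →
      coconeIncl c j q b = y → z = coconeIncl c j n ((F.obj j).mul h a b) := by
  obtain ⟨j, a, b, rfl, rfl⟩ := exists_coconeIncl₂ hc x y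
  refine ⟨coconeIncl c j n ((F.obj j).mul h a b), fun k a' b' ha hb => ?_⟩
  rw [← coconeIncl_trans c (IsFiltered.leftToMax j k),
    ← coconeIncl_trans c (IsFiltered.rightToMax j k), trans_mul, trans_mul]
  apply coconeIncl_mul_eq_of_eq hc
  · rw [coconeIncl_trans, coconeIncl_trans, ha]
  · rw [coconeIncl_trans, coconeIncl_trans, hb]

/-- The product of two elements of a filtered colimit of CDGAs. -/
def colimitMulFun {p q n : ℕ} (h : p + q = n) (x : c.pt.X p) (y : c.pt.X q) : c.pt.X n :=
  (exists_colimitMul hc h x y).choose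

lemma colimitMulFun_incl {p q n : ℕ} (h : p + q = n) (j : J) (a : (F.obj j).X.X p)
    (b : (F.obj j).X.X q) :
    colimitMulFun hc h (coconeIncl c j p a) (coconeIncl c j q b) =
      coconeIncl c j n ((F.obj j).mul h a b) :=
  (exists_colimitMul hc h _ _).choose_spec j a b rfl rfl

/-- The multiplication of a filtered colimit of CDGAs. -/
def colimitMul {p q n : ℕ} (h : p + q = n) : c.pt.X p →ₗ[ℚ] c.pt.X q →ₗ[ℚ] c.pt.X n :=
  LinearMap.mk₂ ℚ (colimitMulFun hc h)
    (fun x x' y => by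
      obtain ⟨j, a, a', b, rfl, rfl, rfl⟩ := exists_coconeIncl₃ hc x x' y
      rw [← map_add, colimitMulFun_incl, colimitMulFun_incl, colimitMulFun_incl, ← map_add,
        map_add, LinearMap.add_apply])
    (fun r x y => by
      obtain ⟨j, a, b, rfl, rfl⟩ := exists_coconeIncl₂ hc x y
      rw [← map_smul, colimitMulFun_incl, colimitMulFun_incl, ← map_smul, map_smul,
        LinearMap.smul_apply])
    (fun x y y' => by
      obtain ⟨j, a, b, b', rfl, rfl, rfl⟩ := exists_coconeIncl₃ hc x y y'
      rw [← map_add, colimitMulFun_incl, colimitMulFun_incl, colimitMulFun_incl, ← map_add,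
        map_add])
    (fun r x y => by
      obtain ⟨j, a, b, rfl, rfl⟩ := exists_coconeIncl₂ hc x y
      rw [← map_smul, colimitMulFun_incl, colimitMulFun_incl, ← map_smul, map_smul])

lemma colimitMul_incl {p q n : ℕ} (h : p + q = n) (j : J) (a : (F.obj j).X.X p)
    (b : (F.obj j).X.X q) :
    colimitMul hc h (coconeIncl c j p a) (coconeIncl c j q b) =
      coconeIncl c j n ((F.obj j).mul h a b) :=
  colimitMulFun_incl hc h j a b

variable (c) in
/-- The unit of a filtered colimit of CDGAs. -/
def colimitOne : c.pt.X 0 :=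
  coconeIncl c (IsFiltered.nonempty (C := J)).some 0 (F.obj _).one

lemma coconeIncl_one (j : J) : coconeIncl c j 0 (F.obj j).one = colimitOne c := by
  unfold colimitOne
  generalize (IsFiltered.nonempty (C := J)).some = k
  rw [← coconeIncl_trans c (IsFiltered.leftToMax j k),
    ← coconeIncl_trans c (IsFiltered.rightToMax j k), trans_one, trans_one]

/-- The filtered colimit of a diagram of CDGAs. -/
def filteredColimitObj : CDGA where
  X := c.pt
  one := colimitOne c
  mul := colimitMul hc
  one_mul h x := by
    obtain ⟨j, a, rfl⟩ := exists_coconeIncl hc x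
    rw [← coconeIncl_one j, colimitMul_incl, CDGA.one_mul]
  mul_one h x := by
    obtain ⟨j, a, rfl⟩ := exists_coconeIncl hc x
    rw [← coconeIncl_one j, colimitMul_incl, CDGA.mul_one]
  mul_assoc hij hjk h h' x y z := by
    obtain ⟨j, a, b, b', rfl, rfl, rfl⟩ := exists_coconeIncl₃ hc x y z
    simp only [colimitMul_incl]
    exact congrArg _ (CDGA.mul_assoc _ _ _ _ _ _ _ _)
  mul_comm h h' x y := by
    obtain ⟨j, a, b, rfl, rfl⟩ := exists_coconeIncl₂ hc x y
    rw [colimitMul_incl, colimitMul_incl, CDGA.mul_comm _ h h', map_smul]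
  leibniz h h₁ h₂ x y := by
    obtain ⟨j, a, b, rfl, rfl⟩ := exists_coconeIncl₂ hc x y
    simp only [colimitMul_incl, ← coconeIncl_d]
    rw [CDGA.leibniz _ h h₁ h₂, map_add, map_smul]

/-- The filtered colimit cocone of CDGAs. -/
def filteredColimitCocone : Cocone F where
  pt := filteredColimitObj hc
  ι :=
    { app := fun j =>
        { map := c.ι.app j
          map_one := coconeIncl_one j
          map_mul := fun h a b => (colimitMul_incl hc h j a b).symm }
      naturality := fun _ _ f => hom_ext' (c.ι.naturality f) }

/-- The filtered colimit cocone of CDGAs is a colimit. -/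
def isColimitFilteredColimitCocone : IsColimit (filteredColimitCocone hc) where
  desc s :=
    { map := hc.desc (U.mapCocone s)
      map_one := by
        let j : J := (IsFiltered.nonempty (C := J)).some
        change ((hc.desc (U.mapCocone s)).f 0).hom (colimitOne c) = _
        rw [← coconeIncl_one j]
        exact (congrArg (fun g => (g.f 0).hom (F.obj j).one)
          (hc.fac (U.mapCocone s) j)).trans (s.ι.app j).map_one
      map_mul := fun {p q n} h x y => by
        have H (j : J) (m : ℕ) (a : (F.obj j).X.X m) :
            ((hc.desc (U.mapCocone s)).f m).hom (coconeIncl c j m a) =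
              ((s.ι.app j).map.f m).hom a :=
          congrArg (fun g => (g.f m).hom a) (hc.fac (U.mapCocone s) j)
        obtain ⟨j, a, b, rfl, rfl⟩ := exists_coconeIncl₂ hc x y
        refine (congrArg _ (colimitMul_incl hc h j a b)).trans ?_
        refine (H _ _ _).trans ?_
        refine ((s.ι.app j).map_mul h a b).trans ?_
        exact (congrArg₂ (fun x y => s.pt.mul h x y) (H _ _ _) (H _ _ _)).symm }
  fac s j := hom_ext' (hc.fac (U.mapCocone s) j)
  uniq s m hm := hom_ext' (hc.uniq (U.mapCocone s) m.map fun j => congrArg Hom.map (hm j))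

end Filtered

/-- The colimit cocone of CDGAs built above lies over the chosen colimit cocone of complexes. -/
instance : PreservesFilteredColimits U where
  preserves_filtered_colimits _ _ _ :=
    ⟨fun {F} => preservesColimit_of_preserves_colimit_cocone
      (isColimitFilteredColimitCocone (colimit.isColimit (F ⋙ U)))
      (colimit.isColimit (F ⋙ U))⟩

instance : IsLocallyPresentable.{0} CDGA := isLocallyPresentable

end CDGA

instance : IsLocallyPresentable.{0} PCDGA := isLocallyPresentable_functor _ _

end IntervalSphere
end

noncomputable section
namespace IntervalSphere
attribute [-instance] CategoryTheory.catToReflQuiver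

/-! ## Polynomials with coefficients in a complex or in a CDGA -/

open scoped TensorProduct
open Polynomial (derivative leval)

/-- Integration of polynomials over the unit interval. -/
def polyIntegral : Polynomial ℚ →ₗ[ℚ] ℚ :=
  Polynomial.lsum fun n => ((n : ℚ) + 1)⁻¹ • LinearMap.id

/-- The fundamental theorem of calculus, checked on monomials. Rational coefficients matter here:
integration divides by `n + 1`. -/
lemma polyIntegral_derivative (p : Polynomial ℚ) :
    polyIntegral (derivative p) = p.eval 1 - p.eval 0 := by
  induction p using Polynomial.induction_on' with
  | add p q hp hq => simp only [map_add, hp, hq, Polynomial.eval_add]; ring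
  | monomial n a =>
    rw [Polynomial.derivative_monomial, polyIntegral, Polynomial.lsum_apply,
      Polynomial.sum_monomial_index _ _ (by simp)]
    rcases n with _ | n
    · simp
    · have : ((n : ℚ) + 1) ≠ 0 := by positivity
      simp
      field_simp

/-- The linear map `ℚ[t] ⊗ M → M` induced by a linear functional on `ℚ[t]`. -/
def polyFunctional (M : Type) [AddCommGroup M] [Module ℚ M] (φ : Polynomial ℚ →ₗ[ℚ] ℚ) :
    Polynomial ℚ ⊗[ℚ] M →ₗ[ℚ] M :=
  (TensorProduct.lid ℚ M).toLinearMap ∘ₗ φ.rTensor M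

lemma polyFunctional_tmul {M : Type} [AddCommGroup M] [Module ℚ M] (φ : Polynomial ℚ →ₗ[ℚ] ℚ)
    (p : Polynomial ℚ) (x : M) : polyFunctional M φ (p ⊗ₜ x) = φ p • x := by
  simp [polyFunctional]

lemma polyFunctional_lTensor {M N : Type} [AddCommGroup M] [Module ℚ M] [AddCommGroup N]
    [Module ℚ N] (φ : Polynomial ℚ →ₗ[ℚ] ℚ) (g : M →ₗ[ℚ] N) (x : Polynomial ℚ ⊗[ℚ] M) :
    polyFunctional N φ (g.lTensor _ x) = g (polyFunctional M φ x) := by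
  induction x with
  | zero => simp only [map_zero]
  | add x y hx hy => simp only [map_add, hx, hy]
  | tmul p x => simp only [LinearMap.lTensor_tmul, polyFunctional_tmul, map_smul]

lemma polyFunctional_integral_derivative {M : Type} [AddCommGroup M] [Module ℚ M]
    (x : Polynomial ℚ ⊗[ℚ] M) :
    polyFunctional M polyIntegral (derivative.rTensor M x) =
      polyFunctional M (leval 1) x - polyFunctional M (leval 0) x := by
  induction x with
  | zero => simp only [map_zero, sub_zero]
  | add x y hx hy => simp only [map_add, hx, hy]; abel
  | tmul p x =>
    simp only [LinearMap.rTensor_tmul, polyFunctional_tmul, polyIntegral_derivative, sub_smul,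
      Polynomial.leval_apply]

/-- The complex `ℚ[t] ⊗ X`. -/
def polyCh (X : Ch) : Ch where
  X n := ModuleCat.of ℚ (Polynomial ℚ ⊗[ℚ] X.X n)
  d i j := ModuleCat.ofHom ((X.d i j).hom.lTensor _)
  shape i j h := by
    rw [X.shape i j h]
    ext1
    exact LinearMap.lTensor_zero _
  d_comp_d' i j k _ _ := by
    ext1
    change LinearMap.lTensor _ _ ∘ₗ LinearMap.lTensor _ _ = 0
    rw [← LinearMap.lTensor_comp, ← ModuleCat.hom_comp, X.d_comp_d]
    exact LinearMap.lTensor_zero _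

/-- The derivative with respect to `t` on `ℚ[t] ⊗ X`. -/
def polyDeriv (X : Ch) (n : ℕ) : (polyCh X).X n →ₗ[ℚ] (polyCh X).X n :=
  derivative.rTensor (X.X n)

lemma polyDeriv_d (X : Ch) (m n : ℕ) (x : (polyCh X).X m) :
    polyDeriv X n (((polyCh X).d m n).hom x) = ((polyCh X).d m n).hom (polyDeriv X m x) :=
  LinearMap.congr_fun ((LinearMap.rTensor_comp_lTensor _ derivative (X.d m n).hom).trans
    (LinearMap.lTensor_comp_rTensor _ derivative (X.d m n).hom).symm)
    (show Polynomial ℚ ⊗[ℚ] X.X m from x)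

/-- Evaluation at a rational number, as a cochain map. -/
def polyEval (X : Ch) (r : ℚ) : polyCh X ⟶ X where
  f n := ModuleCat.ofHom (X := Polynomial ℚ ⊗[ℚ] X.X n) (polyFunctional (X.X n) (leval r))
  comm' i j _ := by
    ext1
    refine LinearMap.ext fun x => ?_
    exact (polyFunctional_lTensor (leval r) (X.d i j).hom x).symm

/-- The inclusion of the constant polynomials, as a cochain map. -/
def polyConst (X : Ch) : X ⟶ polyCh X where
  f n := ModuleCat.ofHom (Y := Polynomial ℚ ⊗[ℚ] X.X n) (TensorProduct.mk ℚ (Polynomial ℚ) _ 1)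
  comm' _ _ _ := rfl

lemma polyDeriv_const (X : Ch) (n : ℕ) (x : X.X n) :
    polyDeriv X n (((polyConst X).f n).hom x) = 0 := by
  change derivative.rTensor _ ((1 : Polynomial ℚ) ⊗ₜ[ℚ] x) = 0
  rw [LinearMap.rTensor_tmul, Polynomial.derivative_one, TensorProduct.zero_tmul]

lemma polyEval_tmul (X : Ch) (r : ℚ) {n : ℕ} (p : Polynomial ℚ) (x : X.X n) :
    ((polyEval X r).f n).hom (p ⊗ₜ[ℚ] x : Polynomial ℚ ⊗[ℚ] X.X n) = p.eval r • x :=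
  polyFunctional_tmul _ _ _

lemma polyConst_eval (X : Ch) (r : ℚ) : polyConst X ≫ polyEval X r = 𝟙 X := by
  ext n x
  refine (polyEval_tmul X r 1 x).trans ?_
  rw [Polynomial.eval_one, one_smul]
  rfl

lemma exists_polyEval_eq (X : Ch) {n : ℕ} (x y : X.X n) :
    ∃ p, ((polyEval X 0).f n).hom p = x ∧ ((polyEval X 1).f n).hom p = y := by
  -- The linear path `(1 - t) x + t y`.
  refine ⟨((1 - Polynomial.X : Polynomial ℚ) ⊗ₜ[ℚ] x + (Polynomial.X : Polynomial ℚ) ⊗ₜ[ℚ] y :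
    Polynomial ℚ ⊗[ℚ] X.X n), ?_, ?_⟩
  all_goals
    refine (map_add (polyFunctional (X.X n) _) _ _).trans ?_
    rw [polyFunctional_tmul, polyFunctional_tmul]
    simp

namespace CDGA

variable (A : CDGA)

/-- The multiplication of `ℚ[t] ⊗ A`. -/
def polyMul {i j n : ℕ} (h : i + j = n) :
    Polynomial ℚ ⊗[ℚ] A.X.X i →ₗ[ℚ] Polynomial ℚ ⊗[ℚ] A.X.X j →ₗ[ℚ] Polynomial ℚ ⊗[ℚ] A.X.X n :=
  TensorProduct.map₂ (LinearMap.mul ℚ (Polynomial ℚ)) (A.mul h)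

lemma polyMul_tmul {i j n : ℕ} (h : i + j = n) (p q : Polynomial ℚ) (a : A.X.X i) (b : A.X.X j) :
    polyMul A h (p ⊗ₜ a) (q ⊗ₜ b) = (p * q) ⊗ₜ A.mul h a b := rfl

/-- The CDGA `ℚ[t] ⊗ A`, in which `t` is a cocycle of degree zero. -/
def polyObj : CDGA where
  X := polyCh A.X
  one := (1 : Polynomial ℚ) ⊗ₜ[ℚ] A.one
  mul h := polyMul A h
  one_mul := by
    intro n h (a : Polynomial ℚ ⊗[ℚ] A.X.X n)
    induction a with
    | zero => exact map_zero _
    | add x y hx hy => exact (map_add _ x y).trans (congrArg₂ _ hx hy)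
    | tmul p x =>
      refine (polyMul_tmul A h 1 p A.one x).trans ?_
      rw [_root_.one_mul, A.one_mul]
  mul_one := by
    intro n h (a : Polynomial ℚ ⊗[ℚ] A.X.X n)
    change polyMul A h a (1 ⊗ₜ A.one) = a
    induction a with
    | zero => simp only [map_zero, LinearMap.zero_apply]
    | add x y hx hy => simp only [map_add, LinearMap.add_apply, hx, hy]
    | tmul p x =>
      rw [polyMul_tmul]
      rw [_root_.mul_one, A.mul_one]
  mul_assoc := by
    intro i j k ij jk n hij hjk h h' (a : Polynomial ℚ ⊗[ℚ] A.X.X i)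
      (b : Polynomial ℚ ⊗[ℚ] A.X.X j) (c : Polynomial ℚ ⊗[ℚ] A.X.X k)
    change polyMul A h (polyMul A hij a b) c = polyMul A h' a (polyMul A hjk b c)
    induction a with
    | zero => simp only [map_zero, LinearMap.zero_apply]
    | add x y hx hy => simp only [map_add, LinearMap.add_apply, hx, hy]
    | tmul p x =>
      induction b with
      | zero => simp only [map_zero, LinearMap.zero_apply]
      | add x y hx hy => simp only [map_add, LinearMap.add_apply, hx, hy]
      | tmul q y =>
        induction c with
        | zero => simp only [map_zero]
        | add x y hx hy => simp only [map_add, hx, hy]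
        | tmul r z =>
          simp only [polyMul_tmul]
          rw [A.mul_assoc hij hjk h h', _root_.mul_assoc]
  mul_comm := by
    intro i j n h h' (a : Polynomial ℚ ⊗[ℚ] A.X.X i) (b : Polynomial ℚ ⊗[ℚ] A.X.X j)
    change polyMul A h a b = (-1 : ℚ) ^ (i * j) • polyMul A h' b a
    induction a with
    | zero => simp only [map_zero, LinearMap.zero_apply, smul_zero]
    | add x y hx hy => simp only [map_add, LinearMap.add_apply, hx, hy, smul_add]
    | tmul p x =>
      induction b with
      | zero => simp only [map_zero, LinearMap.zero_apply, smul_zero]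
      | add x y hx hy => simp only [map_add, LinearMap.add_apply, hx, hy, smul_add]
      | tmul q y =>
        simp only [polyMul_tmul]
        rw [A.mul_comm h h', _root_.mul_comm, TensorProduct.tmul_smul]
  leibniz := by
    intro i j n h h₁ h₂ (a : Polynomial ℚ ⊗[ℚ] A.X.X i) (b : Polynomial ℚ ⊗[ℚ] A.X.X j)
    change LinearMap.lTensor _ (A.X.d n (n + 1)).hom (polyMul A h a b) =
      polyMul A h₁ (LinearMap.lTensor _ (A.X.d i (i + 1)).hom a) b +
        (-1 : ℚ) ^ i • polyMul A h₂ a (LinearMap.lTensor _ (A.X.d j (j + 1)).hom b)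
    induction a with
    | zero => simp only [map_zero, LinearMap.zero_apply, smul_zero, add_zero]
    | add x y hx hy => simp only [map_add, LinearMap.add_apply, hx, hy, smul_add]; abel
    | tmul p x =>
      induction b with
      | zero => simp only [map_zero, smul_zero, add_zero]
      | add x y hx hy => simp only [map_add, hx, hy, smul_add]; abel
      | tmul q y =>
        simp only [polyMul_tmul, LinearMap.lTensor_tmul]
        rw [A.leibniz h h₁ h₂, TensorProduct.tmul_add, TensorProduct.tmul_smul]

lemma polyDeriv_mul {i j n : ℕ} (h : i + j = n) (a : A.polyObj.X.X i) (b : A.polyObj.X.X j) :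
    polyDeriv A.X n (A.polyObj.mul h a b) =
      A.polyObj.mul h (polyDeriv A.X i a) b + A.polyObj.mul h a (polyDeriv A.X j b) := by
  change Polynomial ℚ ⊗[ℚ] A.X.X i at a
  change Polynomial ℚ ⊗[ℚ] A.X.X j at b
  change derivative.rTensor _ (polyMul A h a b) = polyMul A h (derivative.rTensor _ a) b +
    polyMul A h a (derivative.rTensor _ b)
  induction a with
  | zero => simp only [map_zero, LinearMap.zero_apply, add_zero]
  | add x y hx hy => simp only [map_add, LinearMap.add_apply, hx, hy]; abel
  | tmul p x =>
    induction b with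
    | zero => simp only [map_zero, add_zero]
    | add x y hx hy => simp only [map_add, hx, hy]; abel
    | tmul q y =>
      simp only [polyMul_tmul, LinearMap.rTensor_tmul, Polynomial.derivative_mul,
        TensorProduct.add_tmul]

/-- Evaluation at a rational number, as a morphism of CDGAs. -/
def polyEvalHom (r : ℚ) : A.polyObj ⟶ A where
  map := polyEval A.X r
  map_one := by
    refine (polyEval_tmul A.X r 1 A.one).trans ?_
    rw [Polynomial.eval_one, one_smul]
  map_mul := by
    intro i j n h (a : Polynomial ℚ ⊗[ℚ] A.X.X i) (b : Polynomial ℚ ⊗[ℚ] A.X.X j)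
    change polyFunctional _ (leval r) (polyMul A h a b) =
      A.mul h (polyFunctional _ (leval r) a) (polyFunctional _ (leval r) b)
    induction a with
    | zero => simp only [map_zero, LinearMap.zero_apply]
    | add x y hx hy => simp only [map_add, LinearMap.add_apply, hx, hy]
    | tmul p x =>
      induction b with
      | zero => simp only [map_zero]
      | add x y hx hy => simp only [map_add, hx, hy]
      | tmul q y =>
        simp only [polyMul_tmul, polyFunctional_tmul, Polynomial.leval_apply,
          Polynomial.eval_mul, map_smul, LinearMap.smul_apply, mul_smul]
        rw [smul_comm]

/-- The inclusion of the constant polynomials, as a morphism of CDGAs. -/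
def polyConstHom : A ⟶ A.polyObj where
  map := polyConst A.X
  map_one := rfl
  map_mul := by
    intro i j n h a b
    refine Eq.trans ?_ (polyMul_tmul A h 1 1 a b).symm
    rw [_root_.one_mul]
    rfl

end CDGA

end IntervalSphere
end

noncomputable section
namespace IntervalSphere
attribute [-instance] CategoryTheory.catToReflQuiver

/-! ## Adjoining the differential of a derivation -/

/-- The shifted complex `X[-1]` in degree `n`. -/
def shiftX (X : Ch) : ℕ → ModuleCat.{0} ℚ
  | 0 => ModuleCat.of ℚ PUnit
  | n + 1 => X.X n

instance (X : Ch) : Subsingleton (shiftX X 0) := inferInstanceAs (Subsingleton PUnit)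

/-- The differential of the shifted complex. -/
def shiftD (X : Ch) : ∀ n : ℕ, shiftX X n →ₗ[ℚ] shiftX X (n + 1)
  | 0 => 0
  | n + 1 => (X.d n (n + 1)).hom

/-- The identification of `X` in degree `n` with the shift in degree `n + 1`. -/
def toShift (X : Ch) (n : ℕ) : X.X n →ₗ[ℚ] shiftX X (n + 1) := LinearMap.id

lemma shiftD_toShift (X : Ch) (n : ℕ) (x : X.X n) :
    shiftD X (n + 1) (toShift X n x) = toShift X (n + 1) ((X.d n (n + 1)).hom x) := rfl

lemma shiftD_shiftD (X : Ch) (n : ℕ) (x : shiftX X n) :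
    shiftD X (n + 1) (shiftD X n x) = 0 := by
  rcases n with _ | n
  · exact map_zero _
  · exact Ch.d_d_apply X _ _ _ x

/-- An endomorphism of a cochain complex, in terms of its components. -/
structure Ch.Endo (X : Ch) where
  /-- the components -/
  app : ∀ n : ℕ, X.X n →ₗ[ℚ] X.X n
  app_d : ∀ (n : ℕ) (x : X.X n), app (n + 1) ((X.d n (n + 1)).hom x) =
    (X.d n (n + 1)).hom (app n x)

variable {X : Ch} (δ : X.Endo)

/-- The differential of `X ⊕ X ε`, given by `d (a + b ε) = d a + ((-1) ^ n • δ a + d b) ε`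
in degree `n`. -/
def epsD (n : ℕ) : (X.X n × shiftX X n) →ₗ[ℚ] (X.X (n + 1) × shiftX X (n + 1)) :=
  LinearMap.prod ((X.d n (n + 1)).hom ∘ₗ LinearMap.fst ℚ _ _)
    ((-1 : ℚ) ^ n • toShift X n ∘ₗ δ.app n ∘ₗ LinearMap.fst ℚ _ _ + shiftD X n ∘ₗ LinearMap.snd ℚ _ _)

lemma epsD_apply (n : ℕ) (a : X.X n) (b : shiftX X n) :
    epsD δ n (a, b) = ((X.d n (n + 1)).hom a, 
      (-1 : ℚ) ^ n • toShift X n (δ.app n a) + shiftD X n b) := rfl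

/-- The complex `X ⊕ X ε`, with `ε` of degree one. -/
def epsCh : Ch :=
  CochainComplex.of (fun n => ModuleCat.of ℚ (X.X n × shiftX X n))
    (fun n => ModuleCat.ofHom (epsD δ n))
    (fun n => by
      ext1
      refine LinearMap.ext fun ⟨a, b⟩ => ?_
      change epsD δ (n + 1) (epsD δ n (a, b)) = 0
      rw [epsD_apply, epsD_apply]
      refine Prod.ext (Ch.d_d_apply X _ _ _ a) ?_
      change (-1 : ℚ) ^ (n + 1) • toShift X (n + 1) (δ.app (n + 1) ((X.d n (n + 1)).hom a)) +
        shiftD X (n + 1) ((-1 : ℚ) ^ n • toShift X n (δ.app n a) + shiftD X n b) = 0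
      -- The two `δ`-terms cancel, as `δ` commutes with `d` and their signs are `(-1) ^ (n + 1)` and
      -- `(-1) ^ n`.
      rw [map_add, map_smul, shiftD_shiftD, shiftD_toShift, δ.app_d, pow_succ]
      module)

lemma epsCh_d (n : ℕ) : ((epsCh δ).d n (n + 1)).hom = epsD δ n :=
  congrArg ModuleCat.Hom.hom (CochainComplex.of_d (fun n => ModuleCat.of ℚ (X.X n × shiftX X n))
    (fun n => ModuleCat.ofHom (epsD δ n)) n)

/-- The projection `X ⊕ X ε → X`. -/
def epsFst : epsCh δ ⟶ X where
  f n := ModuleCat.ofHom (X := X.X n × shiftX X n) (LinearMap.fst ℚ _ _)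
  comm' := by
    rintro n _ rfl
    ext1
    refine LinearMap.ext fun (x : X.X n × shiftX X n) => ?_
    exact (congrArg Prod.fst (LinearMap.congr_fun (epsCh_d δ n) x)).symm

/-- The map `Y → X ⊕ X ε` induced by a map `Y → X` that `δ` annihilates. -/
def epsLift {Y : Ch} (f : Y ⟶ X) (hf : ∀ (n : ℕ) (y : Y.X n), δ.app n ((f.f n).hom y) = 0) :
    Y ⟶ epsCh δ where
  f n := ModuleCat.ofHom (Y := X.X n × shiftX X n) (LinearMap.prod (f.f n).hom 0)
  comm' := by
    rintro n _ rfl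
    ext1
    refine LinearMap.ext fun y => ?_
    refine (LinearMap.congr_fun (epsCh_d δ n) ((f.f n).hom y, 0)).trans ?_
    change epsD δ n ((f.f n).hom y, 0) = ((f.f (n + 1)).hom ((Y.d n (n + 1)).hom y), 0)
    rw [epsD_apply, hf, map_zero, map_zero, smul_zero, add_zero, Ch.f_d_apply]

namespace CDGA

variable (A : CDGA)

/-- The left action of `A` on its shift. -/
def shiftMulLeft : ∀ {i j n : ℕ}, i + j = n → (A.X.X i →ₗ[ℚ] shiftX A.X j →ₗ[ℚ] shiftX A.X n)
  | _, 0, _, _ => 0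
  | _, _ + 1, 0, _ => 0
  | _, _ + 1, _ + 1, h => A.mul (Nat.succ.inj h)

/-- The right action of `A` on its shift, without signs. -/
def shiftMulRight : ∀ {i j n : ℕ}, i + j = n →
    (shiftX A.X i →ₗ[ℚ] A.X.X j →ₗ[ℚ] shiftX A.X n)
  | 0, _, _, _ => 0
  | _ + 1, _, 0, _ => 0
  | _ + 1, _, _ + 1, h => A.mul (Nat.succ.inj ((Nat.succ_add _ _).symm.trans h))

lemma shiftMulLeft_one {n : ℕ} (h : 0 + n = n) (b : shiftX A.X n) :
    A.shiftMulLeft h A.one b = b := by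
  rcases n with _ | n
  · exact Subsingleton.elim _ _
  · exact A.one_mul _ _

lemma shiftMulRight_one {n : ℕ} (h : n + 0 = n) (b : shiftX A.X n) :
    A.shiftMulRight h b A.one = b := by
  rcases n with _ | n
  · exact Subsingleton.elim _ _
  · exact A.mul_one _ _

section

variable {i j k ij jk n : ℕ} (hij : i + j = ij) (hjk : j + k = jk)
  (h : ij + k = n) (h' : i + jk = n)

lemma shiftMulLeft_mul (a : A.X.X i) (b : A.X.X j) (c : shiftX A.X k) :
    A.shiftMulLeft h (A.mul hij a b) c = A.shiftMulLeft h' a (A.shiftMulLeft hjk b c) := by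
  rcases k with _ | k
  · rw [Subsingleton.elim c 0]; simp only [map_zero]
  obtain _ | jk := jk
  · omega
  obtain _ | n := n
  · omega
  exact A.mul_assoc _ _ _ _ _ _ _

lemma shiftMulRight_shiftMulLeft (a : A.X.X i) (b : shiftX A.X j) (c : A.X.X k) :
    A.shiftMulRight h (A.shiftMulLeft hij a b) c =
      A.shiftMulLeft h' a (A.shiftMulRight hjk b c) := by
  rcases j with _ | j
  · rw [Subsingleton.elim b 0]; simp only [map_zero, LinearMap.zero_apply]
  obtain _ | jk := jk
  · omega
  obtain _ | ij := ij
  · omega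
  obtain _ | n := n
  · omega
  exact A.mul_assoc _ _ _ _ _ _ _

lemma shiftMulRight_mul (a : shiftX A.X i) (b : A.X.X j) (c : A.X.X k) :
    A.shiftMulRight h (A.shiftMulRight hij a b) c = A.shiftMulRight h' a (A.mul hjk b c) := by
  rcases i with _ | i
  · rw [Subsingleton.elim a 0]; simp only [map_zero, LinearMap.zero_apply]
  obtain _ | ij := ij
  · omega
  obtain _ | n := n
  · omega
  exact A.mul_assoc _ _ _ _ _ _ _

end

/-- An element of the shift in degree `j` has degree `j - 1` in `A`, so the Koszul sign is `(-1) ^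
(i * (j - 1))`, written without subtraction. -/
lemma shiftMulLeft_comm {i j n : ℕ} (h : i + j = n) (h' : j + i = n) (a : A.X.X i)
    (b : shiftX A.X j) :
    A.shiftMulLeft h a b = ((-1 : ℚ) ^ (i * j) * (-1) ^ i) • A.shiftMulRight h' b a := by
  rcases j with _ | j
  · rw [Subsingleton.elim b 0]; simp only [map_zero, LinearMap.zero_apply, smul_zero]
  obtain _ | n := n
  · omega
  have : (-1 : ℚ) ^ (i * (j + 1)) * (-1) ^ i = (-1) ^ (i * j) := by
    rw [Nat.mul_succ, pow_add, _root_.mul_assoc, ← pow_add, Even.neg_one_pow ⟨i, rfl⟩,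
      _root_.mul_one]
  rw [this]
  exact A.mul_comm _ _ _ _

lemma shiftMulLeft_toShift {i j n : ℕ} (h : i + j = n) (h₂ : i + (j + 1) = n + 1)
    (a : A.X.X i) (b : A.X.X j) :
    A.shiftMulLeft h₂ a (toShift A.X j b) = toShift A.X n (A.mul h a b) := rfl

lemma shiftMulRight_toShift {i j n : ℕ} (h : i + j = n) (h₁ : (i + 1) + j = n + 1)
    (a : A.X.X i) (b : A.X.X j) :
    A.shiftMulRight h₁ (toShift A.X i a) b = toShift A.X n (A.mul h a b) := rfl

lemma shiftD_shiftMulLeft {i j n : ℕ} (h : i + j = n) (h₁ : (i + 1) + j = n + 1)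
    (h₂ : i + (j + 1) = n + 1) (a : A.X.X i) (b : shiftX A.X j) :
    shiftD A.X n (A.shiftMulLeft h a b) =
      A.shiftMulLeft h₁ ((A.X.d i (i + 1)).hom a) b +
        (-1 : ℚ) ^ i • A.shiftMulLeft h₂ a (shiftD A.X j b) := by
  rcases j with _ | j
  · rw [Subsingleton.elim b 0]; simp only [map_zero, smul_zero, add_zero]
  obtain _ | n := n
  · omega
  exact A.leibniz _ _ _ _ _

/-- The minus sign comes from the shift: the left factor has degree `i - 1` in `A`. -/
lemma shiftD_shiftMulRight {i j n : ℕ} (h : i + j = n) (h₁ : (i + 1) + j = n + 1)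
    (h₂ : i + (j + 1) = n + 1) (a : shiftX A.X i) (b : A.X.X j) :
    shiftD A.X n (A.shiftMulRight h a b) =
      A.shiftMulRight h₁ (shiftD A.X i a) b -
        (-1 : ℚ) ^ i • A.shiftMulRight h₂ a ((A.X.d j (j + 1)).hom b) := by
  rcases i with _ | i
  · rw [Subsingleton.elim a 0]; simp only [map_zero, LinearMap.zero_apply, smul_zero, sub_zero]
  obtain _ | n := n
  · omega
  refine (A.leibniz (by omega) (by omega) (by omega) _ _).trans ?_
  rw [pow_succ, mul_neg, _root_.mul_one, neg_smul, sub_neg_eq_add]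
  rfl

/-- The multiplication of `A ⊕ A ε`, in which `ε` has degree one and square zero. -/
def epsMul {i j n : ℕ} (h : i + j = n) :
    (A.X.X i × shiftX A.X i) →ₗ[ℚ] (A.X.X j × shiftX A.X j) →ₗ[ℚ] (A.X.X n × shiftX A.X n) :=
  LinearMap.mk₂ ℚ
    -- Moving `ε` to the right past `y.1` costs `(-1) ^ j`; the product of the two `ε`-parts
    -- vanishes because `ε ^ 2 = 0`.
    (fun x y => (A.mul h x.1 y.1,
      A.shiftMulLeft h x.1 y.2 + (-1 : ℚ) ^ j • A.shiftMulRight h x.2 y.1))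
    (fun x x' y => by
      refine Prod.ext ?_ ?_
      · simp only [Prod.fst_add, map_add, LinearMap.add_apply]
      · simp only [Prod.fst_add, Prod.snd_add, map_add, LinearMap.add_apply, smul_add]; abel)
    (fun q x y => by
      refine Prod.ext ?_ ?_
      · simp only [Prod.smul_fst, map_smul, LinearMap.smul_apply]
      · simp only [Prod.smul_fst, Prod.smul_snd, map_smul, LinearMap.smul_apply]; module)
    (fun x y y' => by
      refine Prod.ext ?_ ?_
      · simp only [Prod.fst_add, map_add]
      · simp only [Prod.fst_add, Prod.snd_add, map_add, smul_add]; abel)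
    (fun q x y => by
      refine Prod.ext ?_ ?_
      · simp only [Prod.smul_fst, map_smul]
      · simp only [Prod.smul_fst, Prod.smul_snd, map_smul]; module)

lemma epsMul_apply {i j n : ℕ} (h : i + j = n) (a : A.X.X i) (a' : shiftX A.X i) (b : A.X.X j)
    (b' : shiftX A.X j) :
    A.epsMul h (a, a') (b, b') = (A.mul h a b,
      A.shiftMulLeft h a b' + (-1 : ℚ) ^ j • A.shiftMulRight h a' b) := rfl

/-- A derivation of degree zero of a CDGA. -/
structure Derivation extends A.X.Endo where
  app_one : app 0 A.one = 0
  app_mul : ∀ {i j n : ℕ} (h : i + j = n) (a : A.X.X i) (b : A.X.X j),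
    app n (A.mul h a b) = A.mul h (app i a) b + A.mul h a (app j b)

variable {A} (δ : A.Derivation)

/-- In the `ε`-part, the terms with `δ` match by the derivation rule and `(-1) ^ n = (-1) ^ i * (-1)
^ j`; the others match by the Leibniz rules for the two actions on the shift. -/
lemma epsD_epsMul {i j n : ℕ} (h : i + j = n) (h₁ : (i + 1) + j = n + 1)
    (h₂ : i + (j + 1) = n + 1) (a : A.X.X i) (a' : shiftX A.X i) (b : A.X.X j)
    (b' : shiftX A.X j) :
    epsD δ.toEndo n (A.epsMul h (a, a') (b, b')) =
      A.epsMul h₁ (epsD δ.toEndo i (a, a')) (b, b') +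
        (-1 : ℚ) ^ i • A.epsMul h₂ (a, a') (epsD δ.toEndo j (b, b')) := by
  rw [epsD_apply, epsD_apply, epsMul_apply, epsMul_apply, epsMul_apply, epsD_apply]
  refine Prod.ext (A.leibniz _ _ _ _ _) ?_
  simp only [Prod.snd_add, Prod.smul_snd, map_add, map_smul, LinearMap.add_apply,
    LinearMap.smul_apply]
  have hn : (-1 : ℚ) ^ n = (-1) ^ i * (-1) ^ j := by rw [← h, pow_add]
  rw [A.shiftD_shiftMulLeft h h₁ h₂, A.shiftD_shiftMulRight h h₁ h₂, δ.app_mul,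
    A.shiftMulLeft_toShift h, A.shiftMulRight_toShift h, map_add, hn, pow_succ]
  module

/-- The CDGA `A ⊕ A ε` of a derivation. -/
def epsObj : CDGA where
  X := epsCh δ.toEndo
  one := ((A.one, 0) : A.X.X 0 × shiftX A.X 0)
  mul h := A.epsMul h
  one_mul := by
    rintro n h ⟨a, b⟩
    refine (A.epsMul_apply h _ _ _ _).trans ?_
    rw [A.one_mul, shiftMulLeft_one, map_zero, LinearMap.zero_apply, smul_zero, add_zero]
  mul_one := by
    rintro n h ⟨a, b⟩
    refine (A.epsMul_apply h _ _ _ _).trans ?_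
    rw [A.mul_one, shiftMulRight_one, map_zero, pow_zero, one_smul, zero_add]
  mul_assoc := by
    rintro i j k ij _ n hij rfl h h' ⟨a, a'⟩ ⟨b, b'⟩ ⟨c, c'⟩
    have hjk : j + k = j + k := rfl
    change A.epsMul h (A.epsMul hij (a, a') (b, b')) (c, c') =
      A.epsMul h' (a, a') (A.epsMul hjk (b, b') (c, c'))
    simp only [epsMul_apply]
    refine Prod.ext (A.mul_assoc _ _ _ _ _ _ _) ?_
    simp only [map_add, map_smul, LinearMap.add_apply, LinearMap.smul_apply]
    rw [A.shiftMulLeft_mul hij hjk h h', A.shiftMulRight_shiftMulLeft hij hjk h h',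
      A.shiftMulRight_mul hij hjk h h', pow_add]
    module
  mul_comm := by
    rintro i j n h h' ⟨a, a'⟩ ⟨b, b'⟩
    change A.epsMul h (a, a') (b, b') = (-1 : ℚ) ^ (i * j) • A.epsMul h' (b, b') (a, a')
    simp only [epsMul_apply]
    refine Prod.ext (A.mul_comm _ _ _ _) ?_
    change A.shiftMulLeft h a b' + (-1 : ℚ) ^ j • A.shiftMulRight h a' b =
      (-1 : ℚ) ^ (i * j) • (_ + _)
    have hs : (-1 : ℚ) ^ (i * j) * (-1) ^ (i * j) = 1 := by
      rw [← pow_add, Even.neg_one_pow ⟨_, rfl⟩]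
    rw [A.shiftMulLeft_comm h h', A.shiftMulLeft_comm h' h, smul_add, smul_smul, smul_smul,
      Nat.mul_comm j i, ← _root_.mul_assoc, hs, _root_.one_mul, _root_.add_comm]
  leibniz := by
    rintro i j n h h₁ h₂ ⟨a, a'⟩ ⟨b, b'⟩
    exact (LinearMap.congr_fun (epsCh_d δ.toEndo n) (A.epsMul h (a, a') (b, b'))).trans
      ((epsD_epsMul δ h h₁ h₂ a a' b b').trans (congrArg₂
        (fun x y => A.epsMul h₁ x (b, b') + (-1 : ℚ) ^ i • A.epsMul h₂ (a, a') y)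
        (LinearMap.congr_fun (epsCh_d δ.toEndo i) (a, a'))
        (LinearMap.congr_fun (epsCh_d δ.toEndo j) (b, b'))).symm)

/-- The projection `A ⊕ A ε → A`. -/
def epsFstHom : epsObj δ ⟶ A where
  map := epsFst δ.toEndo
  map_one := rfl
  map_mul _ _ _ := rfl

/-- The morphism `B → A ⊕ A ε` induced by a morphism `B → A` that `δ` annihilates. -/
def epsLiftHom {B : CDGA} (f : B ⟶ A)
    (hf : ∀ (n : ℕ) (b : B.X.X n), δ.app n ((f.map.f n).hom b) = 0) : B ⟶ epsObj δ where
  map := epsLift δ.toEndo f.map hf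
  map_one := Prod.ext f.map_one rfl
  map_mul h a b := by
    refine Eq.trans ?_ (A.epsMul_apply h _ _ _ _).symm
    refine Prod.ext (f.map_mul h a b) ?_
    simp only [LinearMap.zero_apply, map_zero, smul_zero, add_zero]
    rfl

end CDGA

end IntervalSphere
end

noncomputable section
namespace IntervalSphere
attribute [-instance] CategoryTheory.catToReflQuiver

/-! ## Path objects -/

/-- The derivative with respect to `t` as an endomorphism of `ℚ[t] ⊗ X`. -/
def polyEndo (X : Ch) : (polyCh X).Endo where
  app := polyDeriv X
  app_d n x := polyDeriv_d X n (n + 1) x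

/-- The difference of the two endpoints of a cocycle in the path object is a coboundary. -/
lemma exists_d_eq_polyEval_sub (X : Ch) (n : ℕ) (p : (epsCh (polyEndo X)).X n)
    (hp : ((epsCh (polyEndo X)).d n (n + 1)).hom p = 0) :
    ∃ z, (X.d (n - 1) n).hom z =
      ((epsFst (polyEndo X) ≫ polyEval X 1).f n).hom p -
        ((epsFst (polyEndo X) ≫ polyEval X 0).f n).hom p := by
  obtain ⟨a, b⟩ := p
  replace hp : epsD (polyEndo X) n (a, b) = 0 :=
    (LinearMap.congr_fun (epsCh_d (polyEndo X) n) (a, b)).symm.trans hp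
  rw [epsD_apply] at hp
  replace hp := congrArg Prod.snd hp
  change (-1 : ℚ) ^ n • toShift (polyCh X) n (polyDeriv X n a) + shiftD (polyCh X) n b = 0 at hp
  have hs : (-1 : ℚ) ^ n * (-1) ^ n = 1 := by rw [← pow_add, Even.neg_one_pow ⟨_, rfl⟩]
  -- The `ε`-part of the cocycle equation expresses the `t`-derivative of `a` as a signed
  -- differential of `b`. Integrating it gives `a(1) - a(0)`, and integration commutes with `d`.
  have ha : toShift (polyCh X) n (polyDeriv X n a) = - (-1 : ℚ) ^ n • shiftD (polyCh X) n b := by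
    have := congrArg ((-1 : ℚ) ^ n • ·) (eq_neg_of_add_eq_zero_left hp)
    simp only [smul_smul, hs, one_smul, smul_neg] at this
    rw [this, neg_smul]
  have key := polyFunctional_integral_derivative (M := X.X n) a
  change polyFunctional (X.X n) polyIntegral (toShift (polyCh X) n (polyDeriv X n a)) = _ at key
  rw [ha] at key
  rcases n with _ | n
  -- In degree zero there is no `ε`-part, so the derivative of `a` vanishes and the two ends
  -- coincide.
  · refine ⟨0, (map_zero _).trans ?_⟩
    refine Eq.trans ?_ key
    refine Eq.trans (map_zero (polyFunctional (X.X 0) polyIntegral)).symm ?_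
    exact congrArg _ (smul_zero _).symm
  · refine ⟨(- (-1 : ℚ) ^ (n + 1)) • polyFunctional (X.X n) polyIntegral b, ?_⟩
    refine Eq.trans ?_ key
    refine (map_smul (X.d n (n + 1)).hom _ _).trans ?_
    refine (congrArg _ (polyFunctional_lTensor polyIntegral (X.d n (n + 1)).hom b).symm).trans ?_
    exact (map_smul (polyFunctional (X.X (n + 1)) polyIntegral) _ _).symm

lemma exists_epsFst_polyEval_eq (X : Ch) (n : ℕ) (x y : X.X n) :
    ∃ p, ((epsFst (polyEndo X) ≫ polyEval X 0).f n).hom p = x ∧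
      ((epsFst (polyEndo X) ≫ polyEval X 1).f n).hom p = y := by
  obtain ⟨p, h₀, h₁⟩ := exists_polyEval_eq X x y
  exact ⟨((p, 0) : (polyCh X).X n × shiftX (polyCh X) n), h₀, h₁⟩

/-- A path object for `B`, with respect to a functor `G` to cochain complexes. -/
structure PathObj {C : Type 1} [Category.{0} C] (G : C ⥤ Ch) (B : C) where
  /-- the path object -/
  P : C
  /-- the constant paths -/
  const : B ⟶ P
  /-- the start of a path -/
  ev₀ : P ⟶ B
  /-- the end of a path -/
  ev₁ : P ⟶ B
  const_ev₀ : const ≫ ev₀ = 𝟙 B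
  const_ev₁ : const ≫ ev₁ = 𝟙 B
  exists_ev_eq : ∀ (n : ℕ) (x y : (G.obj B).X n),
    ∃ p, ((G.map ev₀).f n).hom p = x ∧ ((G.map ev₁).f n).hom p = y
  -- This stands in for the requirement that `const` be a weak equivalence: the two evaluations
  -- agree on cohomology.
  exists_d_eq_sub : ∀ (n : ℕ) (p : (G.obj P).X n), ((G.obj P).d n (n + 1)).hom p = 0 →
    ∃ z, ((G.obj B).d (n - 1) n).hom z =
      ((G.map ev₁).f n).hom p - ((G.map ev₀).f n).hom p

/-- The path object of a cochain complex. -/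
def Ch.pathObj (X : Ch) : PathObj (𝟭 Ch) X where
  P := epsCh (polyEndo X)
  const := epsLift (polyEndo X) (polyConst X) (polyDeriv_const X)
  ev₀ := epsFst (polyEndo X) ≫ polyEval X 0
  ev₁ := epsFst (polyEndo X) ≫ polyEval X 1
  const_ev₀ := polyConst_eval X 0
  const_ev₁ := polyConst_eval X 1
  exists_ev_eq := exists_epsFst_polyEval_eq X
  exists_d_eq_sub := exists_d_eq_polyEval_sub X

/-- The derivative with respect to `t` as a derivation of `ℚ[t] ⊗ A`. -/
def CDGA.polyDerivation (A : CDGA) : A.polyObj.Derivation where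
  toEndo := polyEndo A.X
  app_one := polyDeriv_const A.X 0 A.one
  app_mul := A.polyDeriv_mul

/-- The path object of a CDGA. -/
def CDGA.pathObj (A : CDGA) : PathObj CDGA.U A where
  P := CDGA.epsObj A.polyDerivation
  const := CDGA.epsLiftHom A.polyDerivation A.polyConstHom (polyDeriv_const A.X)
  ev₀ := CDGA.epsFstHom A.polyDerivation ≫ A.polyEvalHom 0
  ev₁ := CDGA.epsFstHom A.polyDerivation ≫ A.polyEvalHom 1
  const_ev₀ := CDGA.hom_ext' (polyConst_eval A.X 0)
  const_ev₁ := CDGA.hom_ext' (polyConst_eval A.X 1)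
  exists_ev_eq := exists_epsFst_polyEval_eq A.X
  exists_d_eq_sub := exists_d_eq_polyEval_sub A.X

/-! ## Maps with the left lifting property with respect to surjections -/

/-- The degreewise surjective maps. -/
def Ch.surjections : MorphismProperty Ch := fun _ _ f => ∀ n, Function.Surjective (f.f n).hom

lemma Ch.surjections_iff {X Y : Ch} (f : X ⟶ Y) :
    Ch.surjections f ↔ ∀ (k : ℕ) (y : D k ⟶ Y), ∃ z : D k ⟶ X, z ≫ f = y := by
  constructor
  · rintro hf (_ | m) y
    · exact ⟨0, D_zero_hom_eq _ _⟩
    · obtain ⟨x, hx⟩ := hf m (diskVal y)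
      obtain ⟨z, rfl⟩ := exists_diskVal x
      exact ⟨z, diskVal_injective hx⟩
  · intro hf n y
    obtain ⟨y, rfl⟩ := exists_diskVal y
    obtain ⟨z, rfl⟩ := hf _ y
    exact ⟨diskVal z, rfl⟩

section

variable {C : Type 1} [Category.{0} C] [HasFiniteProducts C] {F : Ch ⥤ C} {G : C ⥤ Ch}
  (adj : F ⊣ G) (hP : ∀ B : C, Nonempty (PathObj G B))

include adj in
-- Transposed along the adjunction, the target is terminal, so every candidate is a lift.
lemma surjections_map_terminal_from (A : C) : Ch.surjections (G.map (terminal.from A)) := by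
  rw [Ch.surjections_iff]
  intro k y
  refine ⟨0, (adj.homEquiv _ _).symm.injective (Subsingleton.elim _ _)⟩

include adj in
-- By transposition a map from a disk to `G` of the product is determined by its two components,
-- which `exists_ev_eq` realizes as ends of a path.
lemma PathObj.surjections_map_lift {B : C} (P : PathObj G B) :
    Ch.surjections (G.map (prod.lift P.ev₀ P.ev₁)) := by
  rw [Ch.surjections_iff]
  rintro (_ | m) y
  · exact ⟨0, D_zero_hom_eq _ _⟩
  obtain ⟨p, h₀, h₁⟩ := P.exists_ev_eq m (diskVal (y ≫ G.map prod.fst))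
    (diskVal (y ≫ G.map prod.snd))
  obtain ⟨z, rfl⟩ := exists_diskVal p
  rw [← diskVal_comp] at h₀ h₁
  refine ⟨z, (adj.homEquiv _ _).symm.injective ?_⟩
  ext
  · rw [← adj.homEquiv_naturality_right_symm, ← adj.homEquiv_naturality_right_symm, Category.assoc,
      ← G.map_comp, prod.lift_fst]
    exact congrArg _ (diskVal_injective h₀)
  · rw [← adj.homEquiv_naturality_right_symm, ← adj.homEquiv_naturality_right_symm, Category.assoc,
      ← G.map_comp, prod.lift_snd]
    exact congrArg _ (diskVal_injective h₁)

include adj hP in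
/-- A map with the left lifting property with respect to surjections is a quasi-isomorphism. -/
lemma quasiIso_of_llp_surjections {A B : C} (f : A ⟶ B)
    (hf : (Ch.surjections.inverseImage G).llp f) : QuasiIso (G.map f) := by
  obtain ⟨P⟩ := hP B
  -- All objects are fibrant, which yields a retraction of `f`; it gives injectivity on cohomology.
  obtain ⟨g, hg⟩ : ∃ g : B ⟶ A, f ≫ g = 𝟙 A := by
    have := hf _ (surjections_map_terminal_from adj A)
    have sq : CommSq (𝟙 A) f (terminal.from A) (terminal.from B) := ⟨Subsingleton.elim _ _⟩
    exact ⟨sq.lift, sq.fac_left⟩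
  -- A homotopy, constant along `f`, from the identity of `B` to `g ≫ f`; it gives surjectivity on
  -- cohomology.
  obtain ⟨h, h₀, h₁⟩ : ∃ h : B ⟶ P.P, h ≫ P.ev₀ = 𝟙 B ∧ h ≫ P.ev₁ = g ≫ f := by
    have := hf _ (P.surjections_map_lift adj)
    have sq : CommSq (f ≫ P.const) f (prod.lift P.ev₀ P.ev₁) (prod.lift (𝟙 B) (g ≫ f)) := by
      constructor
      ext
      · rw [Category.assoc, Category.assoc, Category.assoc, prod.lift_fst, prod.lift_fst,
          P.const_ev₀]
      · rw [Category.assoc, Category.assoc, Category.assoc, prod.lift_snd, prod.lift_snd,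
          P.const_ev₁, ← Category.assoc, hg, Category.id_comp, Category.comp_id]
    have hl := sq.fac_right
    refine ⟨sq.lift, ?_, ?_⟩
    · have := congrArg (· ≫ prod.fst) hl
      rwa [Category.assoc, prod.lift_fst, prod.lift_fst] at this
    · have := congrArg (· ≫ prod.snd) hl
      rwa [Category.assoc, prod.lift_snd, prod.lift_snd] at this
  have hg' (n : ℕ) (x : (G.obj A).X n) : ((G.map g).f n).hom (((G.map f).f n).hom x) = x := by
    have := congrArg (fun φ => ((G.map φ).f n).hom x) hg
    simpa using this
  rw [Ch.quasiIso_iff]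
  constructor
  · rintro n x - ⟨z, hz⟩
    refine ⟨((G.map g).f (n - 1)).hom z, ?_⟩
    rw [← Ch.f_d_apply, hz, hg']
  · intro n y hy
    refine ⟨((G.map g).f n).hom y, by rw [← Ch.f_d_apply, hy, map_zero], ?_⟩
    obtain ⟨z, hz⟩ := P.exists_d_eq_sub n (((G.map h).f n).hom y) (by
      rw [← Ch.f_d_apply, hy, map_zero])
    refine ⟨-z, ?_⟩
    have h₀' : ((G.map P.ev₀).f n).hom (((G.map h).f n).hom y) = y := by
      have := congrArg (fun φ => ((G.map φ).f n).hom y) h₀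
      simpa using this
    have h₁' : ((G.map P.ev₁).f n).hom (((G.map h).f n).hom y) =
        ((G.map f).f n).hom (((G.map g).f n).hom y) := by
      have := congrArg (fun φ => ((G.map φ).f n).hom y) h₁
      simpa using this
    rw [map_neg, hz, h₀', h₁', neg_sub]

end

/-! ## Trivial cofibrations are pointwise quasi-isomorphisms -/

section

variable {r s : ℝ≥0} {X : Ch}

/-- The projections of a coinduced persistent complex. -/
def coindProj (X : Ch) (a : s ⟶ r) : ((evaluationRightAdjoint Ch r).obj X).obj s ⟶ X :=
  Pi.π (fun _ : s ⟶ r => X) a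

lemma coindProj_hom_ext {K : Ch} {f g : K ⟶ ((evaluationRightAdjoint Ch r).obj X).obj s}
    (h : ∀ a, f ≫ coindProj X a = g ≫ coindProj X a) : f = g := Pi.hom_ext _ _ h

lemma exists_comp_coindProj_eq {K : Ch} (z : (s ⟶ r) → (K ⟶ X)) :
    ∃ f : K ⟶ ((evaluationRightAdjoint Ch r).obj X).obj s, ∀ a, f ≫ coindProj X a = z a :=
  ⟨Pi.lift z, fun _ => limit.lift_π _ _⟩

lemma map_coindProj {t : ℝ≥0} (b : s ⟶ t) (a : t ⟶ r) :
    ((evaluationRightAdjoint Ch r).obj X).map b ≫ coindProj X a = coindProj X (b ≫ a) :=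
  limit.lift_π _ _

lemma map_app_coindProj {Y : Ch} (q : X ⟶ Y) (a : s ⟶ r) :
    ((evaluationRightAdjoint Ch r).map q).app s ≫ coindProj Y a = coindProj X a ≫ q :=
  limit.lift_π _ _

end

/-- The coinduction of a surjection has the right lifting property with respect to `𝕁`. -/
lemma genJ_rlp_evaluationRightAdjoint_map (r : ℝ≥0) {K L : Ch} (q : K ⟶ L)
    (hq : Ch.surjections q) : genJ.rlp ((evaluationRightAdjoint Ch r).map q) := by
  rw [Ch.surjections_iff] at hq
  rintro _ _ _ (⟨hst, k⟩ | ⟨s, k⟩)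
  · rename_i s t
    rw [hasLiftingProperty_pDiskMap_iff]
    intro y w hyw
    have hyw' (a : t ⟶ r) :
        (w ≫ coindProj K a) ≫ q = y ≫ coindProj L (homOfLE hst.le ≫ a) := by
      rw [Category.assoc, ← map_app_coindProj, ← Category.assoc, hyw, Category.assoc,
        map_coindProj]
    have (b : s ⟶ r) : ∃ z : D k ⟶ K, z ≫ q = y ≫ coindProj L b ∧
        ∀ a : t ⟶ r, z = w ≫ coindProj K a := by
      -- If `t ≤ r`, the coinduced object is constant between `s` and `t`, so the lift must be `w`.
      -- Otherwise its value at `t` is terminal and surjectivity of `q` suffices.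
      by_cases htr : t ≤ r
      · exact ⟨w ≫ coindProj K (homOfLE htr), hyw' _, fun a => rfl⟩
      · obtain ⟨z, hz⟩ := hq k (y ≫ coindProj L b)
        exact ⟨z, hz, fun a => (htr (leOfHom a)).elim⟩
    choose z hz hz' using this
    obtain ⟨f, hf⟩ := exists_comp_coindProj_eq z
    refine ⟨f, coindProj_hom_ext fun b => ?_, coindProj_hom_ext fun a => ?_⟩
    · rw [Category.assoc, map_app_coindProj, ← Category.assoc, hf, hz]
    · rw [Category.assoc, map_coindProj, hf, hz']
  · rw [hasLiftingProperty_zero_pDisk_iff]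
    intro y
    choose z hz using fun b => hq k (y ≫ coindProj L b)
    obtain ⟨f, hf⟩ := exists_comp_coindProj_eq z
    refine ⟨f, coindProj_hom_ext fun b => ?_⟩
    rw [Category.assoc, map_app_coindProj, ← Category.assoc, hf, hz]

section

variable {C : Type 1} [Category.{0} C] [HasLimitsOfSize.{0, 0} C] {F : Ch ⥤ C} {G : C ⥤ Ch}
  (adj : F ⊣ G) (hP : ∀ B : C, Nonempty (PathObj G B))

/-- Lifting problems transpose along the adjunction. This identifies the fibrations and trivial
fibrations generated by the images under `F` with preimages under `G`. -/
lemma rlp_strictMap_eq {C D : Type 1} [Category.{0} C] [Category.{0} D] {F : C ⥤ D} {G : D ⥤ C}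
    (adj : F ⊣ G) (W : MorphismProperty C) :
    (W.strictMap F).rlp = W.rlp.inverseImage G := by
  ext X Y p
  constructor
  · intro hp A B i hi
    exact (adj.hasLiftingProperty_iff i p).1 (hp _ ⟨hi⟩)
  · rintro hp _ _ _ ⟨hi⟩
    exact (adj.hasLiftingProperty_iff _ p).2 (hp _ hi)

include adj hP in
lemma quasiIso_of_strictMap_rlp_llp {A B : ℝ≥0 ⥤ C} (f : A ⟶ B)
    (hf : (genJ.strictMap ((Functor.whiskeringRight ℝ≥0 Ch C).obj F)).rlp.llp f) (r : ℝ≥0) :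
    QuasiIso (G.map (f.app r)) := by
  -- Three transpositions follow: evaluation at `r` in `C`, then `F ⊣ G`, then evaluation at `r` in
  -- `Ch`. They reduce the claim to coinduced surjections lifting against 𝕁.
  refine quasiIso_of_llp_surjections adj hP _ fun X Y p hp => ?_
  refine ((evaluationAdjunctionLeft C r).hasLiftingProperty_iff f p).2 (hf _ ?_)
  rintro _ _ _ ⟨hj⟩
  rename_i j
  refine ((evaluationAdjunctionLeft C r).hasLiftingProperty_iff _ p).1 ?_
  refine (adj.hasLiftingProperty_iff (j.app r) p).2 ?_
  exact ((evaluationAdjunctionLeft Ch r).hasLiftingProperty_iff j (G.map p)).2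
    (genJ_rlp_evaluationRightAdjoint_map r _ hp _ hj)

end

/-! ## The model structures -/

instance : MorphismProperty.IsSmall.{0} genI where
  small_toSet := by
    let a : ({p : ℝ≥0 × ℝ≥0 // p.1 < p.2} × ℕ) ⊕ (ℝ≥0 × ℕ) → Arrow PCh :=
      Sum.elim (fun x => Arrow.mk (pSphereToDisk x.1.2 x.2))
        (fun x => Arrow.mk (pSphereTopToDisk x.1 x.2))
    have : genI.toSet ⊆ Set.range a := by
      rintro ⟨f⟩ (⟨h, k⟩ | ⟨s, k⟩)
      · exact ⟨.inl ⟨⟨(_, _), h⟩, k⟩, rfl⟩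
      · exact ⟨.inr ⟨s, k⟩, rfl⟩
    exact small_subset this

instance : MorphismProperty.IsSmall.{0} genJ where
  small_toSet := by
    let a : ({p : ℝ≥0 × ℝ≥0 // p.1 < p.2} × ℕ) ⊕ (ℝ≥0 × ℕ) → Arrow PCh :=
      Sum.elim (fun x => Arrow.mk (pDiskMap x.1.2.le x.2))
        (fun x => Arrow.mk (0 : (0 : PCh) ⟶ pDisk x.1 x.2))
    have : genJ.toSet ⊆ Set.range a := by
      rintro ⟨f⟩ (⟨h, k⟩ | ⟨s, k⟩)
      · exact ⟨.inl ⟨⟨(_, _), h⟩, k⟩, rfl⟩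
      · exact ⟨.inr ⟨s, k⟩, rfl⟩
    exact small_subset this

instance isSmall_strictMap {C D : Type 1} [Category.{0} C] [Category.{0} D] (F : C ⥤ D)
    (W : MorphismProperty C) [MorphismProperty.IsSmall.{0} W] :
    MorphismProperty.IsSmall.{0} (W.strictMap F) where
  small_toSet := by
    have h {X Y : D} (f : X ⟶ Y) : W.strictMap F f → Arrow.mk f ∈ F.mapArrow.obj '' W.toSet := by
      rintro ⟨hf⟩
      exact ⟨Arrow.mk _, hf, rfl⟩
    have : (W.strictMap F).toSet ⊆ F.mapArrow.obj '' W.toSet := fun f hf => h f.hom hf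
    exact small_subset this

/-- The case of the identity adjunction of `Ch`, since whiskering with the identity leaves the
lifting class unchanged. -/
lemma genJ_rlp_llp_le_pW : genJ.rlp.llp ≤ pW := by
  intro X Y f hf r
  refine quasiIso_of_strictMap_rlp_llp (Adjunction.id (C := Ch)) (fun B => ⟨Ch.pathObj B⟩) f ?_ r
  refine MorphismProperty.antitone_llp ?_ _ hf
  rw [rlp_strictMap_eq ((Adjunction.id (C := Ch)).whiskerRight ℝ≥0)]
  exact fun _ _ _ hp => hp

lemma strictMap_genJ_rlp_llp_le : (genJ.strictMap pΛ).rlp.llp ≤ pW.inverseImage pU :=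
  fun _ _ f hf r =>
    quasiIso_of_strictMap_rlp_llp CDGA.freeForget (fun B => ⟨CDGA.pathObj B⟩) f hf r

/-- Both lifting classes are preimages under `pU`, so the equality is pulled back from persistent
complexes. -/
lemma strictMap_genI_rlp_eq :
    (genI.strictMap pΛ).rlp = (genJ.strictMap pΛ).rlp ⊓ pW.inverseImage pU := by
  rw [rlp_strictMap_eq pFreeForget, rlp_strictMap_eq pFreeForget, genI_rlp_eq]
  rfl

end IntervalSphere
end

open IntervalSphere
theorem mainTheorem2 :
    ∃ (_ : ModelCategory PCh) (_ : ModelCategory PCDGA),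
      (weakEquivalences PCh = pW ∧ IsCofibrantlyGeneratedBy genI genJ) ∧
      IsTransferredAlong pU ∧
      weakEquivalences PCDGA = pW.inverseImage pU ∧
      IsCombinatorialBy (genI.strictMap pΛ) (genJ.strictMap pΛ) := by
  obtain ⟨M, hW, hM⟩ :=
    exists_modelCategory_of_isSmall genI genJ pW genI_rlp_eq genJ_rlp_llp_le_pW
  obtain ⟨M', hW', hM'⟩ := exists_modelCategory_of_isSmall (genI.strictMap pΛ)
    (genJ.strictMap pΛ) (pW.inverseImage pU) strictMap_genI_rlp_eq strictMap_genJ_rlp_llp_le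
  refine ⟨M, M', ⟨hW, hM⟩, ⟨by rw [hW', hW], ?_⟩, hW',
    { hM' with isLocallyPresentable := inferInstance }⟩
  rw [hM'.fibrations_eq, hM.fibrations_eq, rlp_strictMap_eq pFreeForget]
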